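/- **Setting.** A finite Markov decision problem $M=(S,A,T,R,\gamma)$ has $|S|=n\ge 2$ states, $|A|=k\ge 2$ actions, transition probabilities $T(s,a,s')\in[0,1]$ with $\sum_{s'}T(s,a,s')=1$, rewards $R(s,a)\in\mathbb R$ and a discount factor $\gamma\in[0,1)$. It is *deterministic* (a DMDP) if $T$ takes values in $\{0,1\}$. For a policy $\pi:S\to A$ let $V^\pi(s)=\mathbb E\big[\sum_{t\ge0}\gamma^tR(s_t,a_t)\big]$, where $s_0=s$, $a_t=\pi(s_t)$, $s_{t+1}\sim T(s_t,a_t,\cdot)$, and let $$\rho^\pi(s,a)=R(s,a)+\gamma\sum_{s'}T(s,a,s')V^\pi(s')-V^\pi(s).$$ A policy is optimal if its value at every state is at least that of every other policy. Put $I^\pi=\{(s,a):\rho^\pi(s,a)>0\}$. A policy improvement step picks any nonempty $I\subseteq I^\pi$ containing at most one pair $(s,a)$ for each $s$, and changes $\pi(s)$ to $a$ for each $(s,a)\in I$, leaving the other actions unchanged. A run of a policy iteration (PI) algorithm with arbitrary action selection is a sequence $\pi_0,\pi_1,\dots$ that starts at any policy, in which each $\pi_{t+1}$ results from $\pi_t$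 by a policy improvement step, for as long as $I^{\pi_t}\ne\emptyset$; it terminates at the first $\pi_\ell$ with $I^{\pi_\ell}=\emptyset$. The choices of $I$ are unrestricted. Howard's PI is the case in which, at each step, every state that has an improving action is switched. Put $$\alpha(k)=\frac{k-1+\sqrt{(k-1)^2+4}}{2},\qquad \varphi=\alpha(2)=\frac{1+\sqrt5}{2}.$$ **Statement.** 1. Every run of any PI algorithm with arbitrary action selection on an $n$-state, $k$-action DMDP ($n,k\ge2$) terminates, at an optimal policy, after a finite number $\ell$ of improvement steps, and the number $\ell+1$ of policies visited satisfies $$\ell+1\le 5n^3k^2\,\alpha(k)^{n-1}.$$ 2. This bound is $O\big(n^3k\,\alpha(k)^n\big)$: there is an absolute constant $C$ with $5n^3k^2\alpha(k)^{n-1}\le C\,n^3k\,\alpha(k)^n$ for all $n,k\ge2$. 3. For $k=2$: there is an absolute constant $C$ such that every run of any PI algorithm on an $n$-state, $2$-action DMDP ($n\ge2$) terminates, at an optimal policy, with $\ell+1\le C\,n^3\varphi^n$. 4. In particular, there is an absolute constant $C$ such that every run of Howard's PI on an $n$-state, $2$-action DMDP ($n\ge2$) terminates, at an optimal policy, with $\ell+1\le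 C\,n^3F_n$, where $F_n$ is the $n$-th Fibonacci number ($F_1=F_2=1$). That is, the number of iterations of Howard's PI grows at most at the Fibonacci rate up to a polynomial factor. -/

import Mathlib

universe u v

/-- A finite Markov decision problem `(S, A, T, R, γ)`: `T s a s'` is the probability of moving to
`s'` when action `a` is taken in state `s`, `R s a` is the expected reward of taking `a` in `s`,
and `γ ∈ [0, 1)` is the discount factor. -/
structure MDP (S A : Type*) [Fintype S] where
  T : S → A → S → ℝ
  T_nonneg : ∀ s a s', 0 ≤ T s a s'
  T_sum : ∀ s a, ∑ s', T s a s' = 1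
  R : S → A → ℝ
  γ : ℝ
  γ_nonneg : 0 ≤ γ
  γ_lt_one : γ < 1

namespace MDP

variable {S A : Type*} [Fintype S]

/-- A deterministic MDP (DMDP): all transition probabilities are `0` or `1`. -/
def IsDeterministic (M : MDP S A) : Prop :=
  ∀ s a s', M.T s a s' = 0 ∨ M.T s a s' = 1

open Classical in
/-- `M.stateProb π s t s'` is the probability that `s_t = s'` for the trajectory which starts at
`s_0 = s` and follows the policy `π`: `a_t = π s_t` and `s_{t+1} ∼ T s_t a_t`. -/
noncomputable def stateProb (M : MDP S A) (π : S → A) (s : S) : ℕ → S → ℝ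
  | 0, s' => if s' = s then 1 else 0
  | t + 1, s' => ∑ u, stateProb M π s t u * M.T u (π u) s'

/-- The expected reward `𝔼[R(s_t, a_t)]` collected at time `t` when starting at `s` and
following `π`. -/
noncomputable def expectedReward (M : MDP S A) (π : S → A) (s : S) (t : ℕ) : ℝ :=
  ∑ u, M.stateProb π s t u * M.R u (π u)

/-- The value function: the expected infinite discounted reward `∑ₜ γ ^ t 𝔼[R(s_t, a_t)]`. -/
noncomputable def value (M : MDP S A) (π : S → A) (s : S) : ℝ :=
  ∑' t : ℕ, M.γ ^ t * M.expectedReward π s t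

theorem stateProb_nonneg (M : MDP S A) (π : S → A) (s : S) (t : ℕ) (u : S) :
    0 ≤ M.stateProb π s t u := by
  induction t generalizing u with
  | zero => unfold stateProb; split_ifs <;> norm_num
  | succ t ih =>
    exact Finset.sum_nonneg fun v _ => mul_nonneg (ih v) (M.T_nonneg _ _ _)

theorem stateProb_sum (M : MDP S A) (π : S → A) (s : S) (t : ℕ) :
    ∑ u, M.stateProb π s t u = 1 := by
  induction t with
  | zero =>
    simp only [stateProb]
    rw [Finset.sum_eq_single s (fun u _ h => if_neg h) (by simp), if_pos rfl]
  | succ t ih =>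
    simp only [stateProb]
    rw [Finset.sum_comm]
    simp only [← Finset.mul_sum, M.T_sum, mul_one, ih]

/-- The series which defines the value function converges (absolutely). -/
theorem summable_value (M : MDP S A) (π : S → A) (s : S) :
    Summable fun t : ℕ => M.γ ^ t * M.expectedReward π s t := by
  refine Summable.of_norm_bounded
    (g := fun t : ℕ => M.γ ^ t * ∑ u, |M.R u (π u)|)
    ((summable_geometric_of_lt_one M.γ_nonneg M.γ_lt_one).mul_right _) fun t => ?_
  rw [Real.norm_eq_abs, abs_mul, abs_of_nonneg (pow_nonneg M.γ_nonneg t)]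
  refine mul_le_mul_of_nonneg_left ?_ (pow_nonneg M.γ_nonneg t)
  refine (Finset.abs_sum_le_sum_abs _ _).trans (Finset.sum_le_sum fun u _ => ?_)
  rw [abs_mul, abs_of_nonneg (M.stateProb_nonneg π s t u)]
  refine mul_le_of_le_one_left (abs_nonneg _) ?_
  rw [← M.stateProb_sum π s t]
  exact Finset.single_le_sum (fun v _ => M.stateProb_nonneg π s t v) (Finset.mem_univ u)

/-- The action value function: take `a` in `s`, and follow `π` thereafter. -/
noncomputable def actionValue (M : MDP S A) (π : S → A) (s : S) (a : A) : ℝ :=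
  M.R s a + M.γ * ∑ s', M.T s a s' * M.value π s'

/-- The gain function `ρ`. -/
noncomputable def gain (M : MDP S A) (π : S → A) (s : S) (a : A) : ℝ :=
  M.actionValue π s a - M.value π s

/-- A policy is optimal if its value at every state is at least that of every policy. -/
def IsOptimal (M : MDP S A) (π : S → A) : Prop :=
  ∀ π' : S → A, ∀ s, M.value π' s ≤ M.value π s

/-- The set of improving state-action pairs of the policy `π`. -/
def improvableSet (M : MDP S A) (π : S → A) : Set (S × A) :=
  {p | 0 < M.gain π p.1 p.2}

/-- A valid improvement set for `π`: a nonempty set of improving state-action pairs with at most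
one action for every state. -/
def IsValidImprovementSet (M : MDP S A) (π : S → A) (I : Set (S × A)) : Prop :=
  I ⊆ M.improvableSet π ∧ I.Nonempty ∧ ∀ s a a', (s, a) ∈ I → (s, a') ∈ I → a = a'

/-- `π'` is obtained from `π` by switching to the actions given by the state-action pairs in `I`
and keeping the action of `π` at all other states. -/
def SwitchesTo (I : Set (S × A)) (π π' : S → A) : Prop :=
  (∀ s a, (s, a) ∈ I → π' s = a) ∧ ∀ s, (∀ a, (s, a) ∉ I) → π' s = π s

/-- `π'` is a locally improving policy of `π`: it results from `π` by one step of policy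
improvement, with arbitrary selection of the states to switch and of their improving actions. -/
def IsLocallyImproving (M : MDP S A) (π π' : S → A) : Prop :=
  ∃ I, M.IsValidImprovementSet π I ∧ SwitchesTo I π π'

/-- One step of Howard's policy iteration: every state with an improving action is switched. -/
def IsHowardImproving (M : MDP S A) (π π' : S → A) : Prop :=
  ∃ I, M.IsValidImprovementSet π I ∧
    (∀ s, (∃ a, (s, a) ∈ M.improvableSet π) → ∃ a, (s, a) ∈ I) ∧ SwitchesTo I π π'

/-- `π 0, π 1, …` is a run of a policy iteration algorithm with arbitrary action selection: as
long as the current policy has an improving action, the next policy results from it by policy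
improvement. The choice of the improvement set at each step is unrestricted, so it may depend on
the past, on further information, or on chance. The run stops at the first policy without improving
actions (see `TerminatesAt`), and the entries after this policy are irrelevant. -/
def IsRun (M : MDP S A) (π : ℕ → S → A) : Prop :=
  ∀ t, (M.improvableSet (π t)).Nonempty → M.IsLocallyImproving (π t) (π (t + 1))

/-- `π 0, π 1, …` is a run of Howard's policy iteration. -/
def IsHowardRun (M : MDP S A) (π : ℕ → S → A) : Prop :=
  ∀ t, (M.improvableSet (π t)).Nonempty → M.IsHowardImproving (π t) (π (t + 1))

/-- The run `π` stops after exactly `ℓ` improvement steps: `π ℓ` is its first policy without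
improving actions. The policies visited are `π 0, …, π ℓ`. -/
def TerminatesAt (M : MDP S A) (π : ℕ → S → A) (ℓ : ℕ) : Prop :=
  (∀ t < ℓ, (M.improvableSet (π t)).Nonempty) ∧ M.improvableSet (π ℓ) = ∅

end MDP

/-- The growth rate `α(k) = (k - 1 + √((k - 1)² + 4)) / 2`. -/
noncomputable def growthRate (k : ℕ) : ℝ :=
  ((k : ℝ) - 1 + Real.sqrt (((k : ℝ) - 1) ^ 2 + 4)) / 2

/-! ### Weighted self-avoiding walks: deletion, contraction, affinity in each row. -/

section PathWeight

variable {V : Type*} [DecidableEq V]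

/-! Along a run the value vectors form a strictly increasing chain, and a chain of vectors is no
longer than the sum of the numbers of values taken in each coordinate
(`Finset.card_image_add_card_le`). In a deterministic problem the value at a state depends only on
the lasso which the policy traces from there: a self-avoiding walk and an action that closes the
cycle. So it suffices to count self-avoiding walks (`card_image_le_sum_pathWeight`).

Parallel actions would spoil this count. At a state where all actions have the same target, however,
a run only ever switches to a higher reward (`MDP.eq_or_reward_lt`). The rewards chosen at these
states split the run into at most n k groups, and within a group each such state has a single
action. At every other state the total weight of the walks is an affine function of the edge
multiplicities, so the worst case is k - 1 actions with one target and a single action with another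
(`exists_rows_pathWeight_le`). What remains is a graph where a vertex has at most a heavy edge of
weight β = k - 1 and a light edge of weight 1, with different targets.

For this graph `pathBound` shows by induction on X that the walks from s inside X weigh at most
cap(s) times the product of the w(v) over v in X. Here cap is β or 1 if only the heavy or only the
light target is available, 0 if neither is, 1 at an end of walks, and α if both are; and w = max(1,
(β cap + 1)/α). Since α² = βα + 1, capacity α gives weight α, so no vertex costs more than α.

In the induction step s has a heavy target u and a light target w, and the claim is βP(u) + P(w) ≤ α
∏ w(v) for the weights P of the two branches. If one target has no in-neighbor in X, the other
branch never meets it, and the definition of w(v) suffices. Otherwise entering a target takes an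
edge away from each of its in-neighbors, whose weights drop by known factors. For β = 1 this is
enough. For β ≥ 2 there are several cases; where the drops alone are too weak, an edge into u is
contracted (`pathWeight_contract`). -/

/-- The total weight of the self-avoiding walks which start at `s`, continue inside `X`, and end by
taking the exit `none`. The weight of a walk is the product of the weights of its edges. -/
noncomputable def pathWeight (W : V → Option V → ℝ) (X : Finset V) (s : V) : ℝ :=
  W s none + ∑ u : X, W s (some u) * pathWeight W (X.erase u) u
termination_by X.card
decreasing_by exact Finset.card_erase_lt_of_mem u.2

theorem pathWeight_eq (W : V → Option V → ℝ) (X : Finset V) (s : V) :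
    pathWeight W X s = W s none + ∑ u ∈ X, W s (some u) * pathWeight W (X.erase u) u := by
  rw [pathWeight]
  congr 1
  exact Finset.sum_coe_sort X fun u => W s (some u) * pathWeight W (X.erase u) u

/-- Walks are self-avoiding, so self-loops are never used; and since s lies outside X, no walk
returns to it. -/
theorem pathWeight_congr {W W' : V → Option V → ℝ} {X : Finset V} {s : V} (hs : s ∉ X)
    (h : ∀ v ∈ insert s X, W v none = W' v none ∧
      ∀ u ∈ X, u ≠ v → W v (some u) = W' v (some u)) :
    pathWeight W X s = pathWeight W' X s := by
  induction X using Finset.strongInduction generalizing s with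
  | H X ih =>
    rw [pathWeight_eq, pathWeight_eq W']
    obtain ⟨h0, h1⟩ := h s (Finset.mem_insert_self _ _)
    rw [h0]
    congr 1
    refine Finset.sum_congr rfl fun u hu => ?_
    rw [h1 u hu (fun e => hs (e ▸ hu)), ih _ (Finset.erase_ssubset hu) (Finset.notMem_erase _ _)]
    intro v hv
    rw [Finset.insert_erase hu] at hv
    obtain ⟨h2, h3⟩ := h v (Finset.mem_insert_of_mem hv)
    exact ⟨h2, fun y hy => h3 y (Finset.mem_of_mem_erase hy)⟩

theorem pathWeight_nonneg {W : V → Option V → ℝ} (hW : ∀ v o, 0 ≤ W v o) (X : Finset V) (s : V) :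
    0 ≤ pathWeight W X s := by
  induction X using Finset.strongInduction generalizing s with
  | H X ih =>
    rw [pathWeight_eq]
    exact add_nonneg (hW _ _) (Finset.sum_nonneg fun u hu =>
      mul_nonneg (hW _ _) (ih _ (Finset.erase_ssubset hu) u))

theorem pathWeight_update_of_notMem (W : V → Option V → ℝ) {X : Finset V} {s v : V} (hs : s ∉ X)
    (hv : v ∉ insert s X) (f : Option V → ℝ) :
    pathWeight (Function.update W v f) X s = pathWeight W X s := by
  refine pathWeight_congr hs fun y hy => ?_
  have : y ≠ v := fun h => hv (h ▸ hy)
  simp [Function.update_of_ne this]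

/-- A vertex without incoming edges can be deleted. -/
theorem pathWeight_erase {W : V → Option V → ℝ} {X : Finset V} {s u : V} (hs : s ∉ X)
    (hu : u ∈ X) (h : ∀ v ∈ insert s X, v ≠ u → W v (some u) = 0) :
    pathWeight W X s = pathWeight W (X.erase u) s := by
  induction X using Finset.strongInduction generalizing s with
  | H X ih =>
    rw [pathWeight_eq, pathWeight_eq W (X.erase u), ← Finset.add_sum_erase _ _ hu,
      h s (Finset.mem_insert_self _ _) (fun e => hs (e ▸ hu)), zero_mul, zero_add]
    congr 1
    refine Finset.sum_congr rfl fun y hy => ?_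
    obtain ⟨hyu, hyX⟩ := Finset.mem_erase.1 hy
    rw [ih _ (Finset.erase_ssubset hyX) (Finset.notMem_erase _ _)
      (Finset.mem_erase.2 ⟨hyu.symm, hu⟩), Finset.erase_right_comm]
    intro v hv
    rw [Finset.insert_erase hyX] at hv
    exact h v (Finset.mem_insert_of_mem hv)

/-- The walks through the edge from `v` to `u` correspond to the walks through `v` in the graph
where `u` is deleted and `v` takes over the outgoing edges of `u`. -/
theorem pathWeight_contract (W : V → Option V → ℝ) {X : Finset V} {s u v : V} (hs : s ∉ X)
    (hu : u ∈ X) (hvu : v ≠ u) :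
    pathWeight W X s =
      pathWeight (Function.update W v (Function.update (W v) (some u) 0)) X s +
        W v (some u) * (pathWeight (Function.update W v (W u)) (X.erase u) s -
          pathWeight (Function.update W v 0) (X.erase u) s) := by
  induction X using Finset.strongInduction generalizing s with
  | H X ih =>
    have hsu : s ≠ u := fun e => hs (e ▸ hu)
    -- If s = v, the contracted edge can only be the first one, and no continuation sees the row of
    -- v again. Otherwise the identity passes through the first edge; the branch that starts at u
    -- uses no edge into u and is the same on both sides.
    by_cases hsv : s = v
    · subst hsv
      have key : ∀ f : Option V → ℝ, ∀ Y ⊆ X, ∀ y ∈ Y,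
          pathWeight (Function.update W s f) (Y.erase y) y = pathWeight W (Y.erase y) y := by
        intro f Y hY y hy
        apply pathWeight_update_of_notMem _ (Finset.notMem_erase _ _)
        rw [Finset.insert_erase hy]
        exact fun h => hs (hY h)
      have h1 : ∀ f : Option V → ℝ, ∀ Y ⊆ X, pathWeight (Function.update W s f) Y s =
          f none + ∑ y ∈ Y, f (some y) * pathWeight W (Y.erase y) y := by
        intro f Y hY
        rw [pathWeight_eq, Function.update_self]
        congr 1
        exact Finset.sum_congr rfl fun y hy => by rw [key f Y hY y hy]
      rw [h1 _ X subset_rfl, h1 _ _ (Finset.erase_subset _ _), h1 _ _ (Finset.erase_subset _ _),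
        ← pathWeight_eq W (X.erase u) u, pathWeight_eq W X s, ← Finset.add_sum_erase _ _ hu,
        ← Finset.add_sum_erase X (fun y => Function.update (W s) (some u) 0 (some y) *
          pathWeight W (X.erase y) y) hu]
      have h2 : ∑ y ∈ X.erase u, Function.update (W s) (some u) 0 (some y) *
          pathWeight W (X.erase y) y = ∑ y ∈ X.erase u, W s (some y) *
          pathWeight W (X.erase y) y := by
        refine Finset.sum_congr rfl fun y hy => ?_
        rw [Function.update_of_ne]
        simpa using Finset.ne_of_mem_erase hy
      rw [h2]
      simp
      ring
    · have h1 : ∀ f : Option V → ℝ, ∀ Y, pathWeight (Function.update W v f) Y s =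
          W s none + ∑ y ∈ Y, W s (some y) * pathWeight (Function.update W v f) (Y.erase y) y := by
        intro f Y
        rw [pathWeight_eq, Function.update_of_ne hsv]
      rw [h1, h1, h1, pathWeight_eq W X s, ← Finset.add_sum_erase _ _ hu,
        ← Finset.add_sum_erase X (fun y => W s (some y) * pathWeight
          (Function.update W v (Function.update (W v) (some u) 0)) (X.erase y) y) hu]
      have h2 : pathWeight (Function.update W v (Function.update (W v) (some u) 0))
          (X.erase u) u = pathWeight W (X.erase u) u := by
        refine pathWeight_congr (Finset.notMem_erase _ _) fun y _ => ?_
        by_cases hyv : y = v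
        · subst hyv
          refine ⟨by simp, fun x hx _ => ?_⟩
          have : x ≠ u := Finset.ne_of_mem_erase hx
          simp [this]
        · simp [Function.update_of_ne hyv]
      rw [h2]
      have h3 : ∀ y ∈ X.erase u, W s (some y) * pathWeight W (X.erase y) y =
          W s (some y) * pathWeight
            (Function.update W v (Function.update (W v) (some u) 0)) (X.erase y) y +
          W v (some u) * (W s (some y) *
            pathWeight (Function.update W v (W u)) ((X.erase u).erase y) y -
            W s (some y) * pathWeight (Function.update W v 0) ((X.erase u).erase y) y) := by
        intro y hy
        obtain ⟨hyu, hyX⟩ := Finset.mem_erase.1 hy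
        rw [ih _ (Finset.erase_ssubset hyX) (Finset.notMem_erase _ _)
          (Finset.mem_erase.2 ⟨hyu.symm, hu⟩), Finset.erase_right_comm]
        ring
      rw [Finset.sum_congr rfl h3, Finset.sum_add_distrib, ← Finset.mul_sum,
        Finset.sum_sub_distrib]
      ring

/-- The weight of the walks is an affine function of each row of the weights. -/
theorem pathWeight_update_eq {W : V → Option V → ℝ} (hW : ∀ v o, 0 ≤ W v o) (X : Finset V)
    {s : V} (hs : s ∉ X) (v : V) :
    ∃ (a b : ℝ) (c : V → ℝ), (∀ y, 0 ≤ c y) ∧ ∀ f : Option V → ℝ,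
      pathWeight (Function.update W v f) X s = a + f none * b + ∑ y ∈ X, f (some y) * c y := by
  induction X using Finset.strongInduction generalizing s with
  | H X ih =>
    -- A self-avoiding walk leaves v at most once, so its weight contains at most one entry of the
    -- row f.
    by_cases hsv : s = v
    · subst hsv
      refine ⟨0, 1, fun y => pathWeight W (X.erase y) y, fun y => pathWeight_nonneg hW _ _,
        fun f => ?_⟩
      rw [pathWeight_eq, Function.update_self, zero_add, mul_one]
      congr 1
      refine Finset.sum_congr rfl fun y hy => ?_
      rw [pathWeight_update_of_notMem _ (Finset.notMem_erase _ _)]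
      rw [Finset.insert_erase hy]
      exact hs
    · choose! a b c hc h using fun y (hy : y ∈ X) =>
        ih _ (Finset.erase_ssubset hy) (Finset.notMem_erase y X)
      refine ⟨W s none + ∑ y ∈ X, W s (some y) * a y, ∑ y ∈ X, W s (some y) * b y,
        fun x => ∑ y ∈ X.erase x, W s (some y) * c y x,
        fun x => Finset.sum_nonneg fun y hy =>
          mul_nonneg (hW _ _) (hc y (Finset.mem_of_mem_erase hy) x), fun f => ?_⟩
      rw [pathWeight_eq, Function.update_of_ne hsv, add_assoc, add_assoc]
      congr 1
      rw [Finset.mul_sum]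
      beta_reduce
      have e : ∑ x ∈ X, f (some x) * ∑ y ∈ X.erase x, W s (some y) * c y x =
          ∑ y ∈ X, ∑ x ∈ X.erase y, f (some x) * (W s (some y) * c y x) := by
        simp_rw [Finset.mul_sum]
        refine Finset.sum_comm' fun x y => ?_
        simp only [Finset.mem_erase]
        tauto
      rw [e, ← Finset.sum_add_distrib, ← Finset.sum_add_distrib]
      refine Finset.sum_congr rfl fun y hy => ?_
      rw [h y hy f, mul_add, mul_add, Finset.mul_sum]
      rw [add_assoc]
      congr 1
      congr 1
      · ring
      · exact Finset.sum_congr rfl fun x _ => by ring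

end PathWeight

/-! ### Inequalities in α and β behind the case analysis. -/

section Inequalities

variable {α β : ℝ}

/-- Both bounds reflect α (α - β) = 1. -/
theorem root_bounds (hβ : 1 ≤ β) (hα : 0 < α) (h : α ^ 2 = β * α + 1) :
    β < α ∧ α ≤ β + 1 := by
  constructor
  · nlinarith
  · nlinarith

theorem root_cube (h : α ^ 2 = β * α + 1) : α ^ 3 = (β ^ 2 + 1) * α + β := by
  linear_combination (α + β) * h

/-- The weight of a vertex with capacity `x`. -/
noncomputable def capWeight (α β x : ℝ) : ℝ := max 1 ((β * x + 1) / α)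

theorem one_le_capWeight (x : ℝ) : 1 ≤ capWeight α β x := le_max_left _ _

theorem capWeight_mono (hβ : 1 ≤ β) (hα : 0 < α) {x y : ℝ} (h : x ≤ y) :
    capWeight α β x ≤ capWeight α β y := by
  unfold capWeight
  gcongr

theorem le_mul_capWeight (hα : 0 < α) (x : ℝ) : β * x + 1 ≤ α * capWeight α β x := by
  rw [mul_comm α, ← div_le_iff₀ hα]
  exact le_max_right _ _

theorem capWeight_of_one_le (hβ : 1 ≤ β) (hα : 0 < α) (h : α ^ 2 = β * α + 1) {x : ℝ}
    (hx : 1 ≤ x) : capWeight α β x = (β * x + 1) / α := by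
  apply max_eq_right
  rw [le_div_iff₀ hα, one_mul]
  nlinarith [(root_bounds hβ hα h).2]

theorem capWeight_zero (hβ : 1 ≤ β) (hα : 0 < α) (h : α ^ 2 = β * α + 1) :
    capWeight α β 0 = 1 := by
  apply max_eq_left
  rw [div_le_iff₀ hα]
  linarith [(root_bounds hβ hα h).1]

/-- This fixed point is what makes α the growth rate: a vertex with both edges available has
capacity α and also costs α. -/
theorem capWeight_self (hβ : 1 ≤ β) (hα : 0 < α) (h : α ^ 2 = β * α + 1) :
    capWeight α β α = α := by
  rw [capWeight_of_one_le hβ hα h (by linarith [(root_bounds hβ hα h).1]), ← h]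
  field_simp

theorem capWeight_beta (hβ : 1 ≤ β) (hα : 0 < α) (h : α ^ 2 = β * α + 1) :
    capWeight α β β = (β ^ 2 + 1) / α := by
  rw [capWeight_of_one_le hβ hα h hβ, pow_two]

theorem capWeight_one (hβ : 1 ≤ β) (hα : 0 < α) (h : α ^ 2 = β * α + 1) :
    capWeight α β 1 = (β + 1) / α := by
  rw [capWeight_of_one_le hβ hα h le_rfl, mul_one]

/-- Since α - β = 1/α, the inequality x ≤ (βx + 1)/α amounts to x ≤ α. It allows the start of a walk
to be charged like any other vertex. -/
theorem le_capWeight (hα : 0 < α) (h : α ^ 2 = β * α + 1) {x : ℝ} (hx : x ≤ α) :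
    x ≤ capWeight α β x := by
  refine le_trans ?_ (le_max_right _ _)
  rw [le_div_iff₀ hα]
  have h1 : 0 < α - β := pos_of_mul_pos_right (by linarith : 0 < α * (α - β)) hα.le
  nlinarith

theorem capWeight_le (hβ : 1 ≤ β) (hα : 0 < α) (h : α ^ 2 = β * α + 1) {x : ℝ} (hx : x ≤ α) :
    capWeight α β x ≤ α :=
  (capWeight_mono hβ hα hx).trans_eq (capWeight_self hβ hα h)

/-- If the target of the light edge has no other incoming edges. -/
theorem add_le_mul_capWeight (hβ : 1 ≤ β) (hα : 0 < α) (h : α ^ 2 = β * α + 1) {x : ℝ}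
    (hx : x = 0 ∨ 1 ≤ x) : β + x ≤ α * capWeight α β x := by
  obtain rfl | hx := hx
  · rw [capWeight_zero hβ hα h]
    linarith [(root_bounds hβ hα h).1]
  · refine le_trans ?_ (le_mul_capWeight hα x)
    nlinarith

/-- The factor by which the weight of a vertex drops when it loses its light edge. -/
noncomputable def lossRatio (α β : ℝ) : ℝ := (β ^ 2 + 1) / α ^ 2

theorem lossRatio_pos (hα : 0 < α) : 0 < lossRatio α β := by
  unfold lossRatio; positivity

theorem lossRatio_le_one (hβ : 1 ≤ β) (hα : 0 < α) (h : α ^ 2 = β * α + 1) :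
    lossRatio α β ≤ 1 := by
  unfold lossRatio
  rw [div_le_one (by positivity), h]
  nlinarith [(root_bounds hβ hα h).1]

theorem capWeight_beta_eq (hβ : 1 ≤ β) (hα : 0 < α) (h : α ^ 2 = β * α + 1) :
    capWeight α β β = lossRatio α β * α := by
  rw [capWeight_beta hβ hα h, lossRatio]
  field_simp

/-- The loss of the only edge of a vertex, in terms of the light edge. -/
theorem inv_capWeight_one_le (hβ : 2 ≤ β) (hα : 0 < α) (h : α ^ 2 = β * α + 1) :
    α / (β + 1) ≤ lossRatio α β := by
  unfold lossRatio
  rw [div_le_div_iff₀ (by positivity) (by positivity)]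
  have h3 := root_cube h
  have h1 := (root_bounds (by linarith) hα h).1
  have e : α * (β - α) = -1 := by linarith
  have : α * α ^ 2 = (β ^ 2 + 1) * α + β := by rw [← h3]; ring
  rw [this]
  nlinarith [mul_nonneg (by nlinarith : (0:ℝ) ≤ β ^ 2 + 1) (by nlinarith : (0:ℝ) ≤ β + 1 - α - 1/2)]

/-- The bound for the loss of a heavy edge. -/
noncomputable def heavyLoss (α β : ℝ) : ℝ := max ((β + 1) / α ^ 2) (α / (β ^ 2 + 1))

theorem heavyLoss_le (hβ : 1 ≤ β) (hα : 0 < α) (h : α ^ 2 = β * α + 1) :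
    heavyLoss α β ≤ α / (β + 1) := by
  have h3 := root_cube h
  have h1 := (root_bounds (by linarith) hα h).1
  apply max_le
  · rw [div_le_div_iff₀ (by positivity) (by positivity)]
    nlinarith
  · gcongr
    nlinarith

/-- Settles the case of a heavy edge into the heavy target: the branch of weight β loses
`heavyLoss`, the other one `lossRatio`. For the second term of the maximum, both summands are at
most α/2. -/
theorem beta_mul_heavyLoss (hβ : 1 ≤ β) (hα : 0 < α) (h : α ^ 2 = β * α + 1) :
    β * heavyLoss α β + lossRatio α β ≤ α := by
  have h3 := root_cube h
  have h1 := (root_bounds (by linarith) hα h).1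
  unfold heavyLoss
  rw [mul_max_of_nonneg _ _ (by linarith), ← le_sub_iff_add_le]
  apply max_le <;> rw [le_sub_iff_add_le]
  · unfold lossRatio
    rw [← mul_div_assoc, ← add_div, div_le_iff₀ (by positivity)]
    nlinarith [mul_nonneg (by linarith : (0:ℝ) ≤ α - β) (by positivity : 0 ≤ β ^ 2 + 1),
      mul_nonneg (by linarith : (0:ℝ) ≤ β - 1) (sq_nonneg β), sq_nonneg (β - 1)]
  · have := lossRatio_le_one hβ hα h
    have h4 : β * (α / (β ^ 2 + 1)) ≤ α / 2 := by
      rw [← mul_div_assoc, div_le_div_iff₀ (by positivity) (by positivity)]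
      nlinarith [sq_nonneg (β - 1)]
    have h5 : lossRatio α β ≤ α / 2 := by
      rw [lossRatio, div_le_div_iff₀ (by positivity) (by positivity)]
      have e : α * α ^ 2 = (β ^ 2 + 1) * α + β := by rw [← h3]; ring
      -- Follows from α - β = 1/α and α ≤ β + 1; the cruder bound β ≤ α would not do here.
      have h6 : β + 1 / (β + 1) ≤ α := by
        have : 1 / (β + 1) ≤ 1 / α := by gcongr; exact (root_bounds hβ hα h).2
        have : 1 / α = α - β := by rw [div_eq_iff hα.ne']; linarith
        linarith
      have h7 : (β ^ 2 + 1) * (2 - (β + 1 / (β + 1))) ≤ β := by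
        have : (2 - (β + 1 / (β + 1))) = (1 + β - β ^ 2) / (β + 1) := by field_simp; ring
        rw [this, ← mul_div_assoc, div_le_iff₀ (by positivity)]
        have : 0 ≤ (β - 1) * (β ^ 3 + β + 1) := mul_nonneg (by linarith) (by positivity)
        nlinarith
      rw [e]
      have : 0 ≤ (β ^ 2 + 1) * (α - (β + 1 / (β + 1))) :=
        mul_nonneg (by positivity) (by linarith)
      linarith
    linarith

/-- The counterpart for a heavy edge into the light target. -/
theorem heavyLoss_add (hβ : 1 ≤ β) (hα : 0 < α) (h : α ^ 2 = β * α + 1) :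
    β * lossRatio α β + heavyLoss α β ≤ α := by
  have h3 := root_cube h
  have h1 := (root_bounds (by linarith) hα h).1
  unfold heavyLoss lossRatio
  rw [← max_add_add_left]
  apply max_le
  · rw [← mul_div_assoc, ← add_div, div_le_iff₀ (by positivity)]
    nlinarith [mul_nonneg (by linarith : (0:ℝ) ≤ α - β) (by positivity : 0 ≤ β ^ 2 + 1)]
  · rw [← mul_div_assoc, div_add_div _ _ (by positivity) (by positivity),
      div_le_iff₀ (by positivity)]
    have : α * α ^ 2 = (β ^ 2 + 1) * α + β := by rw [← h3]; ring
    have : α * (α ^ 2 * (β ^ 2 + 1)) = ((β ^ 2 + 1) * α + β) * (β ^ 2 + 1) := by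
      rw [← this]; ring
    rw [this]
    have : α ^ 2 * α = (β ^ 2 + 1) * α + β := by rw [← h3]; ring
    rw [this]
    have h2 := (root_bounds (by linarith) hα h).2
    -- Multiplying the gap by α and eliminating α² leaves an expression whose sign follows from α ≤
    -- β + 1.
    have key : α * (((β ^ 2 + 1) * α + β) * (β ^ 2 + 1) -
        (β * (β ^ 2 + 1) * (β ^ 2 + 1) + ((β ^ 2 + 1) * α + β))) =
        β * (β * (β ^ 2 + 1) - α) := by
      linear_combination ((β ^ 2 + 1) ^ 2 - (β ^ 2 + 1)) * h
    have : 0 ≤ β * (β * (β ^ 2 + 1) - α) := mul_nonneg (by linarith) (by nlinarith)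
    rw [← key] at this
    exact sub_nonneg.1 (nonneg_of_mul_nonneg_right this hα)

/-- Settles the case where the heavy target has at least two in-neighbors, one of which has no other
available edge: that one loses α/(β + 1), a second one loses `lossRatio`. -/
theorem lossRatio_single (hβ : 1 ≤ β) (hα : 0 < α) (h : α ^ 2 = β * α + 1) :
    β * (lossRatio α β * (α / (β + 1))) + lossRatio α β ≤ α := by
  have h3 := root_cube h
  obtain ⟨h1, h2⟩ := (root_bounds (by linarith) hα h)
  have e : β * (lossRatio α β * (α / (β + 1))) + lossRatio α β =
      lossRatio α β * (β * α + β + 1) / (β + 1) := by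
    field_simp
    ring
  rw [e, div_le_iff₀ (by positivity), lossRatio, div_mul_eq_mul_div, div_le_iff₀ (by positivity)]
  have : α * (β + 1) * α ^ 2 = ((β ^ 2 + 1) * α + β) * (β + 1) := by
    rw [← h3]; ring
  rw [this]
  nlinarith

theorem lossRatio_base (hβ : 1 ≤ β) (hα : 0 < α) (h : α ^ 2 = β * α + 1) :
    lossRatio α β * (α ^ 2 + lossRatio α β) ≤ α ^ 2 := by
  have h3 := root_cube h
  obtain ⟨h1, h2⟩ := (root_bounds (by linarith) hα h)
  have e : lossRatio α β * α ^ 2 = β ^ 2 + 1 := by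
    unfold lossRatio; field_simp
  rw [mul_add, e]
  have e2 : lossRatio α β * lossRatio α β = (β ^ 2 + 1) ^ 2 / α ^ 3 / α := by
    unfold lossRatio; field_simp
  have h4 : (β ^ 2 + 1) ^ 2 / α ^ 3 ≤ β := by
    rw [div_le_iff₀ (by positivity), h3]
    have key : α * (β * ((β ^ 2 + 1) * α + β) - (β ^ 2 + 1) ^ 2) = β * (β ^ 2 + 1) - α := by
      linear_combination β * (β ^ 2 + 1) * h
    have : 0 ≤ β * (β ^ 2 + 1) - α := by nlinarith
    rw [← key] at this
    exact sub_nonneg.1 (nonneg_of_mul_nonneg_right this hα)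
  have h5 : (β ^ 2 + 1) ^ 2 / α ^ 3 / α ≤ β / α := by gcongr
  have h6 : α ^ 2 = β ^ 2 + 1 + β / α := by
    field_simp
    linear_combination h3
  rw [e2]
  linarith

/-- Write ρ for `lossRatio`. A further factor ρ outweighs a further summand 1, that is, ρ (α² + ρ +
i + 1) ≤ α² + ρ + i. So the linear growth in the number of in-neighbors, which contraction produces,
is harmless. -/
theorem lossRatio_pow (hβ : 1 ≤ β) (hα : 0 < α) (h : α ^ 2 = β * α + 1) (i : ℕ) :
    lossRatio α β ^ (i + 1) * (α ^ 2 + lossRatio α β + i) ≤ α ^ 2 := by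
  have hρ := lossRatio_pos (β := β) hα
  have hρ1 := lossRatio_le_one hβ hα h
  have h0 := lossRatio_base hβ hα h
  induction i with
  | zero => simpa using h0
  | succ i ih =>
    refine le_trans ?_ ih
    rw [pow_succ, mul_assoc]
    gcongr
    push_cast
    have : 0 ≤ (i : ℝ) * (1 - lossRatio α β) := mul_nonneg i.cast_nonneg (by linarith)
    nlinarith

/-- Here i + 1 is the number of in-neighbors of the heavy target. The first term is its own branch;
the second is the branch of the light target by `pathWeight_le_of_light_neighbors`, with one more
factor `lossRatio` from an in-neighbor of the light target. -/
theorem light_neighbors_bound (hβ : 1 ≤ β) (hα : 0 < α) (h : α ^ 2 = β * α + 1) {x : ℝ}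
    (hx : x ≤ α) (i : ℕ) :
    β * (lossRatio α β ^ (i + 1) * x / capWeight α β x) + lossRatio α β *
      (lossRatio α β ^ (i + 1) * (1 / capWeight α β x + (i + 1) / capWeight α β β)) ≤ α := by
  have hρ := lossRatio_pos (β := β) hα
  have hρ1 := lossRatio_le_one hβ hα h
  set ρ := lossRatio α β
  have hw0 := one_le_capWeight (α := α) (β := β) x
  have hw1 := capWeight_le hβ hα h hx
  have hw2 := le_mul_capWeight (β := β) hα x
  rw [capWeight_beta_eq hβ hα h]
  set w := capWeight α β x
  have e : β * (ρ ^ (i + 1) * x / w) + ρ * (ρ ^ (i + 1) * (1 / w + (i + 1) / (ρ * α))) =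
      ρ ^ (i + 1) * ((β * x + ρ) / w + (i + 1) / α) := by
    field_simp
    ring
  have h1 : (β * x + ρ) / w + (i + 1) / α ≤ (α ^ 2 + ρ + i) / α := by
    have : (β * x + ρ) / w ≤ α - (1 - ρ) / α := by
      rw [div_le_iff₀ (by positivity)]
      have : (1 - ρ) / α * w ≤ 1 - ρ := by
        rw [div_mul_eq_mul_div, div_le_iff₀ hα]
        exact mul_le_mul_of_nonneg_left hw1 (by linarith)
      nlinarith
    have e2 : (α ^ 2 + ρ + i) / α = α - (1 - ρ) / α + (i + 1) / α := by field_simp; ring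
    rw [e2]
    gcongr
  rw [e]
  calc _ ≤ ρ ^ (i + 1) * ((α ^ 2 + ρ + i) / α) := by gcongr
    _ = ρ ^ (i + 1) * (α ^ 2 + ρ + i) / α := by ring
    _ ≤ α ^ 2 / α := by
      have := lossRatio_pow hβ hα h i
      gcongr
    _ = α := by field_simp

/-- Equality holds at x = β, and the right side grows faster. This sharpens `add_le_mul_capWeight`
for a vertex which has a heavy edge, hence capacity at least β. -/
theorem add_mul_le_capWeight (hβ : 1 ≤ β) (hα : 0 < α) (h : α ^ 2 = β * α + 1) {x : ℝ}
    (hx : β ≤ x) : β + x ≤ 2 * α * β / (β ^ 2 + 1) * capWeight α β x := by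
  rw [capWeight_of_one_le hβ hα h (hβ.trans hx)]
  have e : 2 * α * β / (β ^ 2 + 1) * ((β * x + 1) / α) = 2 * β * (β * x + 1) / (β ^ 2 + 1) := by
    field_simp
  rw [e, le_div_iff₀ (by positivity)]
  nlinarith [mul_nonneg (by nlinarith : (0 : ℝ) ≤ β ^ 2 - 1) (sub_nonneg.2 hx)]

/-- For the case where the heavy target u has a light edge that is the only edge into w, and w has a
heavy edge. The first exponent is j, not j + 1, because w itself may be one of the j + 1
in-neighbors of u. -/
theorem shared_target_bound (hβ : 2 ≤ β) (hα : 0 < α) (h : α ^ 2 = β * α + 1) (j : ℕ) :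
    β * (2 * α * β / (β ^ 2 + 1) * lossRatio α β ^ j) +
      lossRatio α β ^ (j + 1) * (1 + (j + 1)) ≤ α ^ 2 := by
  have hβ1 : 1 ≤ β := by linarith
  refine le_trans ?_ (lossRatio_pow hβ1 hα h j)
  have hρ := lossRatio_pos (β := β) hα
  have e : lossRatio α β * α ^ 2 = β ^ 2 + 1 := by
    unfold lossRatio; field_simp
  set ρ := lossRatio α β
  have h1 : β * (2 * α * β / (β ^ 2 + 1)) ≤ β ^ 2 := by
    rw [← mul_div_assoc, div_le_iff₀ (by positivity)]
    have : 2 * α ≤ β ^ 2 + 1 := by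
      have := root_bounds hβ1 hα h
      have : α ≤ β + 1 / 2 := by nlinarith
      nlinarith
    nlinarith [mul_nonneg (sq_nonneg β) (sub_nonneg.2 this)]
  have h2 : β * (2 * α * β / (β ^ 2 + 1)) + ρ * (1 + (j + 1)) ≤ ρ * (α ^ 2 + ρ + j) := by
    nlinarith [sq_nonneg (ρ - 1)]
  calc _ = ρ ^ j * (β * (2 * α * β / (β ^ 2 + 1)) + ρ * (1 + (j + 1))) := by ring
    _ ≤ ρ ^ j * (ρ * (α ^ 2 + ρ + j)) := by gcongr
    _ = _ := by ring

/-- The same situation when w has only a light edge. The factor (β² + 1)/(β(β + 1)) is what remains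
after this edge has been compared to a heavy one. -/
theorem shared_target_bound' (hβ : 2 ≤ β) (hα : 0 < α) (h : α ^ 2 = β * α + 1) (j : ℕ) :
    β * (α * lossRatio α β ^ (j + 1)) + (β ^ 2 + 1) / (β * (β + 1)) *
      (lossRatio α β ^ (j + 1) * (1 + (j + 1))) ≤ α ^ 2 := by
  have hβ1 : 1 ≤ β := by linarith
  refine le_trans ?_ (lossRatio_pow hβ1 hα h j)
  have hρ := lossRatio_pos (β := β) hα
  have hρ1 := lossRatio_le_one hβ1 hα h
  have h1 : (β ^ 2 + 1) / (β * (β + 1)) ≤ lossRatio α β := by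
    unfold lossRatio
    gcongr
    nlinarith [(root_bounds hβ1 hα h).2]
  set ρ := lossRatio α β
  calc _ = ρ ^ (j + 1) * (β * α + (β ^ 2 + 1) / (β * (β + 1)) * (1 + (j + 1))) := by ring
    _ ≤ ρ ^ (j + 1) * (β * α + ρ * (1 + (j + 1))) := by gcongr
    _ ≤ ρ ^ (j + 1) * (α ^ 2 + ρ + j) := by
      gcongr ρ ^ (j + 1) * ?_
      have : 0 ≤ ((j : ℝ) + 1) * (1 - ρ) := mul_nonneg (by positivity) (by linarith)
      nlinarith

end Inequalities

/-! ### Rows with a heavy and a light edge, and the loss when a target disappears. -/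

section PathBound

variable {V : Type*}

/-- The outgoing edges of a vertex: it is either the end of the walks, or has at most one heavy edge
and at most one light edge. -/
inductive PathRow (V : Type*)
  | halt : PathRow V
  | edges (h l : Option V) : PathRow V

namespace PathRow

variable [DecidableEq V]

/-- The weights of the edges: `β` for the heavy edge and `1` for the light edge. -/
noncomputable def weight (β : ℝ) : PathRow V → Option V → ℝ
  | halt, none => 1
  | halt, some _ => 0
  | edges _ _, none => 0
  | edges h l, some y => (if h = some y then β else 0) + (if l = some y then 1 else 0)

/-- The heavy edge and the light edge do not have the same target. -/
def IsValid : PathRow V → Prop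
  | halt => True
  | edges h l => ∀ y, h = some y → l ≠ some y

/-- A bound for the contribution of the edges with target in `Y`. -/
noncomputable def capacity (α β : ℝ) (Y : Finset V) : PathRow V → ℝ
  | halt => 1
  | edges h l =>
    if ∃ y ∈ Y, h = some y then (if ∃ y ∈ Y, l = some y then α else β)
    else if ∃ y ∈ Y, l = some y then 1 else 0

theorem weight_nonneg {β : ℝ} (hβ : 1 ≤ β) (R : PathRow V) (o : Option V) : 0 ≤ R.weight β o := by
  rcases R with _ | ⟨h, l⟩ <;> rcases o with _ | y <;> simp only [weight] <;> try norm_num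
  split_ifs <;> linarith

theorem capacity_mono {α β : ℝ} (hβ : 1 ≤ β) (hα : β ≤ α) {Y Z : Finset V} (h : Y ⊆ Z)
    (R : PathRow V) : R.capacity α β Y ≤ R.capacity α β Z := by
  rcases R with _ | ⟨a, b⟩
  · rfl
  · have h1 : ∀ o : Option V, (∃ y ∈ Y, o = some y) → ∃ y ∈ Z, o = some y :=
      fun o ⟨y, hy, e⟩ => ⟨y, h hy, e⟩
    have ha := h1 a
    have hb := h1 b
    simp only [capacity]
    split_ifs <;> first
      | linarith
      | exact absurd (ha (by assumption)) (by assumption)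
      | exact absurd (hb (by assumption)) (by assumption)

theorem capacity_le {α β : ℝ} (hβ : 1 ≤ β) (hα : β ≤ α) (Y : Finset V) (R : PathRow V) :
    R.capacity α β Y ≤ α := by
  rcases R with _ | ⟨a, b⟩
  · exact hβ.trans hα
  · simp only [capacity]
    split_ifs <;> linarith

theorem capacity_eq_zero_or {α β : ℝ} (hβ : 1 ≤ β) (hα : β ≤ α) (Y : Finset V) (R : PathRow V) :
    R.capacity α β Y = 0 ∨ 1 ≤ R.capacity α β Y := by
  rcases R with _ | ⟨a, b⟩
  · exact Or.inr le_rfl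
  · simp only [capacity]
    split_ifs <;> first | (right; linarith) | (left; rfl)

theorem capacity_nonneg {α β : ℝ} (hβ : 1 ≤ β) (hα : β ≤ α) (Y : Finset V) (R : PathRow V) :
    0 ≤ R.capacity α β Y := by
  rcases R.capacity_eq_zero_or hβ hα Y with h | h <;> linarith

theorem exists_mem_erase_iff {Y : Finset V} {u : V} (o : Option V) :
    (∃ y ∈ Y.erase u, o = some y) ↔ (∃ y ∈ Y, o = some y) ∧ o ≠ some u := by
  constructor
  · rintro ⟨y, hy, rfl⟩
    exact ⟨⟨y, Finset.mem_of_mem_erase hy, rfl⟩, by simpa using Finset.ne_of_mem_erase hy⟩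
  · rintro ⟨⟨y, hy, rfl⟩, h⟩
    exact ⟨y, Finset.mem_erase.2 ⟨by simpa using h, hy⟩, rfl⟩

theorem weight_ne_zero {β : ℝ} {R : PathRow V} {u : V} (h : R.weight β (some u) ≠ 0) :
    ∃ a b, R = edges a b ∧ (a = some u ∨ b = some u) := by
  rcases R with _ | ⟨a, b⟩
  · exact absurd rfl h
  · refine ⟨a, b, rfl, ?_⟩
    by_contra! H
    simp [weight, H.1, H.2] at h

section Loss

variable {α β : ℝ}

/-- The capacity drops from α to 1 if the light edge is available, and from β to 0 otherwise: these
are the two terms of `heavyLoss`. -/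
theorem capWeight_erase_heavy (hβ : 1 ≤ β) (hα : 0 < α) (h : α ^ 2 = β * α + 1)
    {Y : Finset V} {u : V} (hu : u ∈ Y) {b : Option V}
    (hb : b ≠ some u) :
    capWeight α β ((edges (some u) b).capacity α β (Y.erase u)) ≤
      heavyLoss α β * capWeight α β ((edges (some u) b).capacity α β Y) := by
  have h1 : ∃ y ∈ Y, some u = some y := ⟨u, hu, rfl⟩
  have hb' : (b = some u) = False := eq_false hb
  simp only [capacity, exists_mem_erase_iff, hb', h1, ne_eq]
  by_cases hl : ∃ y ∈ Y, b = some y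
  · simp only [hl, not_true_eq_false, not_false_eq_true, and_true, and_false, if_true,
      if_false]
    rw [capWeight_one hβ hα h, capWeight_self hβ hα h]
    calc (β + 1) / α = (β + 1) / α ^ 2 * α := by field_simp
      _ ≤ _ := by gcongr; exact le_max_left _ _
  · simp only [hl, not_true_eq_false, and_false, if_true, false_and,
      if_false]
    rw [capWeight_zero hβ hα h, capWeight_beta hβ hα h]
    calc (1 : ℝ) = α / (β ^ 2 + 1) * ((β ^ 2 + 1) / α) := by field_simp
      _ ≤ _ := by gcongr; exact le_max_right _ _

theorem capWeight_erase_light (hβ : 1 ≤ β) (hα : 0 < α) (h : α ^ 2 = β * α + 1)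
    {Y : Finset V} {u : V} (hu : u ∈ Y) {a : Option V}
    (ha : a ≠ some u) (ha' : ∃ y ∈ Y, a = some y) :
    capWeight α β ((edges a (some u)).capacity α β (Y.erase u)) =
      lossRatio α β * capWeight α β ((edges a (some u)).capacity α β Y) := by
  have h1 : ∃ y ∈ Y, some u = some y := ⟨u, hu, rfl⟩
  have hb' : (a = some u) = False := eq_false ha
  simp only [capacity, exists_mem_erase_iff, hb', h1, ha', ne_eq]
  simp only [not_true_eq_false, not_false_eq_true, and_true, and_false, if_true,
      if_false]
  rw [capWeight_beta_eq hβ hα h, capWeight_self hβ hα h]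

theorem capWeight_erase_light_only (hβ : 1 ≤ β) (hα : 0 < α) (h : α ^ 2 = β * α + 1)
    {Y : Finset V} {u : V} (hu : u ∈ Y) {a : Option V}
    (ha' : ¬ ∃ y ∈ Y, a = some y) :
    capWeight α β ((edges a (some u)).capacity α β (Y.erase u)) =
      α / (β + 1) * capWeight α β ((edges a (some u)).capacity α β Y) := by
  have h1 : ∃ y ∈ Y, some u = some y := ⟨u, hu, rfl⟩
  simp only [capacity, exists_mem_erase_iff, h1, ha']
  simp only [ne_eq, not_true_eq_false, false_and, and_false, if_true,
      if_false]
  rw [capWeight_zero hβ hα h, capWeight_one hβ hα h]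
  field_simp

/-- The loss of any edge. -/
theorem capWeight_erase_le (hβ : 1 ≤ β) (hα : 0 < α) (h : α ^ 2 = β * α + 1)
    {Y : Finset V} {u : V} (hu : u ∈ Y) {R : PathRow V} (hR : R.IsValid)
    (hw : R.weight β (some u) ≠ 0) :
    capWeight α β (R.capacity α β (Y.erase u)) ≤
      max (lossRatio α β) (α / (β + 1)) * capWeight α β (R.capacity α β Y) := by
  have h0 : ∀ x, 0 ≤ capWeight α β x := fun x => zero_le_one.trans (one_le_capWeight x)
  obtain ⟨a, b, rfl, rfl | rfl⟩ := weight_ne_zero hw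
  · refine (capWeight_erase_heavy hβ hα h hu (hR u rfl)).trans ?_
    exact mul_le_mul_of_nonneg_right ((heavyLoss_le hβ hα h).trans (le_max_right _ _)) (h0 _)
  · by_cases ha : ∃ y ∈ Y, a = some y
    · rw [capWeight_erase_light hβ hα h hu (fun e => hR u e rfl) ha]
      exact mul_le_mul_of_nonneg_right (le_max_left _ _) (h0 _)
    · rw [capWeight_erase_light_only hβ hα h hu ha]
      exact mul_le_mul_of_nonneg_right (le_max_right _ _) (h0 _)

end Loss

end PathRow

theorem Finset.prod_le_prod_mul_prod [DecidableEq V] {T N : Finset V} (hN : N ⊆ T) {f g c : V → ℝ}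
    (hf : ∀ z ∈ T, 0 ≤ f z) (hfg : ∀ z ∈ T, f z ≤ g z) (hc : ∀ z ∈ N, f z ≤ c z * g z) :
    ∏ z ∈ T, f z ≤ (∏ z ∈ N, c z) * ∏ z ∈ T, g z := by
  rw [← Finset.prod_sdiff hN, ← Finset.prod_sdiff (f := g) hN,
    mul_left_comm, ← Finset.prod_mul_distrib]
  have h1 : ∀ z ∈ T \ N, 0 ≤ f z := fun z hz => hf z (Finset.sdiff_subset hz)
  refine mul_le_mul (Finset.prod_le_prod h1 fun z hz => hfg z (Finset.sdiff_subset hz))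
    (Finset.prod_le_prod (fun z hz => hf z (hN hz)) hc)
    (Finset.prod_nonneg fun z hz => hf z (hN hz))
    (Finset.prod_nonneg fun z hz => (h1 z hz).trans (hfg z (Finset.sdiff_subset hz)))

theorem Finset.prod_le_pow_card_mul [DecidableEq V] {T N : Finset V} (hN : N ⊆ T) {f g : V → ℝ}
    {c : ℝ} (hf : ∀ z ∈ T, 0 ≤ f z) (hfg : ∀ z ∈ T, f z ≤ g z) (hc : ∀ z ∈ N, f z ≤ c * g z) :
    ∏ z ∈ T, f z ≤ c ^ N.card * ∏ z ∈ T, g z := by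
  simpa using Finset.prod_le_prod_mul_prod (c := fun _ => c) hN hf hfg hc

end PathBound

/-! ### The inductive bound and its use for single branches. -/

section PathBoundInduction

variable {V : Type*} [DecidableEq V]

/-- The edge weights given by the rows `r`. -/
noncomputable def rowsWeight (β : ℝ) (r : V → PathRow V) : V → Option V → ℝ :=
  fun v => (r v).weight β

/-- The weight of the vertex `v` in the bound for the walks inside `X`. -/
noncomputable def vertexWeight (α β : ℝ) (r : V → PathRow V) (X : Finset V) (v : V) : ℝ :=
  capWeight α β ((r v).capacity α β (X.erase v))

/-- The total weight of the walks inside `X` is at most the product of the vertex weights. -/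
def PathBound (α β : ℝ) (X : Finset V) : Prop :=
  ∀ r : V → PathRow V, (∀ v, (r v).IsValid) → ∀ s ∉ X,
    pathWeight (rowsWeight β r) X s ≤
      (r s).capacity α β X * ∏ v ∈ X, vertexWeight α β r X v

theorem rowsWeight_update (β : ℝ) (r : V → PathRow V) (v : V) (R : PathRow V) :
    rowsWeight β (Function.update r v R) = Function.update (rowsWeight β r) v (R.weight β) := by
  funext x
  by_cases h : x = v
  · subst h; simp [rowsWeight]
  · simp [rowsWeight, h]

theorem one_le_vertexWeight (α β : ℝ) (r : V → PathRow V) (X : Finset V) (v : V) :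
    1 ≤ vertexWeight α β r X v := one_le_capWeight _

theorem vertexWeight_pos (α β : ℝ) (r : V → PathRow V) (X : Finset V) (v : V) :
    0 < vertexWeight α β r X v := zero_lt_one.trans_le (one_le_vertexWeight ..)

theorem one_le_prod_vertexWeight (α β : ℝ) (r : V → PathRow V) (X Y : Finset V) :
    1 ≤ ∏ v ∈ Y, vertexWeight α β r X v :=
  Finset.prod_induction _ (1 ≤ ·) (fun _ _ => one_le_mul_of_one_le_of_one_le) le_rfl
    fun _ _ => one_le_vertexWeight ..

variable {α β : ℝ}

theorem rowsWeight_nonneg (hβ : 1 ≤ β) (r : V → PathRow V) (v : V) (o : Option V) :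
    0 ≤ rowsWeight β r v o := (r v).weight_nonneg hβ o

theorem capacity_le_vertexWeight (hβ : 1 ≤ β) (hα : 0 < α) (h : α ^ 2 = β * α + 1)
    (r : V → PathRow V) (X : Finset V) (v : V) :
    (r v).capacity α β (X.erase v) ≤ vertexWeight α β r X v :=
  le_capWeight hα h ((r v).capacity_le hβ (root_bounds hβ hα h).1.le _)

theorem vertexWeight_mono (hβ : 1 ≤ β) (hα : 0 < α) (h : α ^ 2 = β * α + 1)
    (r : V → PathRow V) {X Y : Finset V} (hXY : X ⊆ Y) (v : V) :
    vertexWeight α β r X v ≤ vertexWeight α β r Y v :=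
  capWeight_mono hβ hα ((r v).capacity_mono hβ (root_bounds hβ hα h).1.le
    (Finset.erase_subset_erase _ hXY))

theorem vertexWeight_erase_le (hβ : 1 ≤ β) (hα : 0 < α) (h : α ^ 2 = β * α + 1)
    {r : V → PathRow V} {X : Finset V} {u v : V} (hr : (r v).IsValid) (hu : u ∈ X) (huv : v ≠ u)
    (hw : rowsWeight β r v (some u) ≠ 0) :
    vertexWeight α β r (X.erase u) v ≤
      max (lossRatio α β) (α / (β + 1)) * vertexWeight α β r X v := by
  rw [vertexWeight, Finset.erase_right_comm]
  exact PathRow.capWeight_erase_le hβ hα h (Finset.mem_erase.2 ⟨huv.symm, hu⟩) hr hw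

theorem vertexWeight_erase_heavy (hβ : 1 ≤ β) (hα : 0 < α) (h : α ^ 2 = β * α + 1)
    {r : V → PathRow V} {X : Finset V} {u v : V} (hr : (r v).IsValid) (hu : u ∈ X) (huv : v ≠ u)
    {b : Option V} (hv : r v = .edges (some u) b) :
    vertexWeight α β r (X.erase u) v ≤ heavyLoss α β * vertexWeight α β r X v := by
  rw [hv] at hr
  rw [vertexWeight, vertexWeight, Finset.erase_right_comm, hv]
  exact PathRow.capWeight_erase_heavy hβ hα h (Finset.mem_erase.2 ⟨huv.symm, hu⟩) (hr u rfl)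

theorem vertexWeight_erase_light (hβ : 1 ≤ β) (hα : 0 < α) (h : α ^ 2 = β * α + 1)
    {r : V → PathRow V} {X : Finset V} {u v y : V} (hr : (r v).IsValid) (hu : u ∈ X) (huv : v ≠ u)
    (hy : y ∈ X) (hyv : y ≠ v) (hv : r v = .edges (some y) (some u)) :
    vertexWeight α β r (X.erase u) v = lossRatio α β * vertexWeight α β r X v := by
  rw [hv] at hr
  rw [vertexWeight, vertexWeight, Finset.erase_right_comm, hv]
  exact PathRow.capWeight_erase_light hβ hα h (Finset.mem_erase.2 ⟨huv.symm, hu⟩)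
    (fun e => hr y rfl (by rw [← e])) ⟨y, Finset.mem_erase.2 ⟨hyv, hy⟩, rfl⟩

theorem vertexWeight_erase_light_only (hβ : 1 ≤ β) (hα : 0 < α) (h : α ^ 2 = β * α + 1)
    {r : V → PathRow V} {X : Finset V} {u v : V} (hu : u ∈ X) (huv : v ≠ u)
    {a : Option V} (ha : ¬ ∃ y ∈ X.erase v, a = some y) (hv : r v = .edges a (some u)) :
    vertexWeight α β r (X.erase u) v = α / (β + 1) * vertexWeight α β r X v := by
  rw [vertexWeight, vertexWeight, Finset.erase_right_comm, hv]
  exact PathRow.capWeight_erase_light_only hβ hα h (Finset.mem_erase.2 ⟨huv.symm, hu⟩) ha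

namespace PathBound

theorem le_prod (hβ : 1 ≤ β) (hα : 0 < α) (h : α ^ 2 = β * α + 1) {X : Finset V}
    (hX : PathBound α β X) {r : V → PathRow V} (hr : ∀ v, (r v).IsValid) {s : V} (hs : s ∉ X) :
    pathWeight (rowsWeight β r) X s ≤ ∏ v ∈ insert s X, vertexWeight α β r X v := by
  refine (hX r hr s hs).trans ?_
  rw [Finset.prod_insert hs]
  refine mul_le_mul_of_nonneg_right ?_ (zero_le_one.trans (one_le_prod_vertexWeight ..))
  have := capacity_le_vertexWeight hβ hα h r X s
  rwa [Finset.erase_eq_of_notMem hs] at this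

/-- The walks inside `X` which start at `u ∈ X`, when `z ∈ N` loses a factor `c z`. -/
theorem branch_le (hβ : 1 ≤ β) (hα : 0 < α) (h : α ^ 2 = β * α + 1) {X : Finset V} {u : V}
    (hX : PathBound α β (X.erase u)) {r : V → PathRow V} (hr : ∀ v, (r v).IsValid)
    {N : Finset V} (hN : N ⊆ X.erase u) {c : V → ℝ}
    (hc : ∀ z ∈ N, vertexWeight α β r (X.erase u) z ≤ c z * vertexWeight α β r X z) :
    pathWeight (rowsWeight β r) (X.erase u) u ≤ (r u).capacity α β (X.erase u) *
      ((∏ z ∈ N, c z) * ∏ v ∈ X.erase u, vertexWeight α β r X v) := by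
  refine (hX r hr u (Finset.notMem_erase _ _)).trans ?_
  refine mul_le_mul_of_nonneg_left ?_ ((r u).capacity_nonneg hβ (root_bounds hβ hα h).1.le _)
  exact Finset.prod_le_prod_mul_prod hN (fun z _ => (vertexWeight_pos ..).le)
    (fun z _ => vertexWeight_mono hβ hα h r (Finset.erase_subset _ _) z) hc

/-- The start u is charged its own weight, which completes the product to all of X. In this form the
losses at the in-neighbors of u become factors in front of a common product. -/
theorem branch_le' (hβ : 1 ≤ β) (hα : 0 < α) (h : α ^ 2 = β * α + 1) {X : Finset V} {u : V}
    (hX : PathBound α β (X.erase u)) {r : V → PathRow V} (hr : ∀ v, (r v).IsValid) (hu : u ∈ X)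
    {N : Finset V} (hN : N ⊆ X.erase u) {c : V → ℝ} (hc0 : ∀ z ∈ N, 0 ≤ c z)
    (hc : ∀ z ∈ N, vertexWeight α β r (X.erase u) z ≤ c z * vertexWeight α β r X z) :
    pathWeight (rowsWeight β r) (X.erase u) u ≤
      (∏ z ∈ N, c z) * ∏ v ∈ X, vertexWeight α β r X v := by
  refine (hX.branch_le hβ hα h hr hN hc).trans ?_
  rw [← Finset.mul_prod_erase X _ hu, mul_left_comm]
  have := one_le_prod_vertexWeight α β r X (X.erase u)
  have := Finset.prod_nonneg hc0
  gcongr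
  exact capacity_le_vertexWeight hβ hα h r X u

theorem branch_le_one (hβ : 1 ≤ β) (hα : 0 < α) (h : α ^ 2 = β * α + 1) {X : Finset V} {u v : V}
    (hX : PathBound α β (X.erase u)) {r : V → PathRow V} (hr : ∀ v, (r v).IsValid) (hu : u ∈ X)
    (hv : v ∈ X.erase u) {c : ℝ} (hc0 : 0 ≤ c)
    (hc : vertexWeight α β r (X.erase u) v ≤ c * vertexWeight α β r X v) :
    pathWeight (rowsWeight β r) (X.erase u) u ≤ c * ∏ v ∈ X, vertexWeight α β r X v := by
  have := hX.branch_le' hβ hα h hr hu (N := {v}) (c := fun _ => c) (by simpa using hv)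
    (by simpa using hc0) (by simpa using hc)
  simpa using this

/-- The walks inside `X` which start at `y ∈ X`, when `u` has no incoming edges. -/
theorem branch_le_of_isolated (hβ : 1 ≤ β) (hα : 0 < α) (h : α ^ 2 = β * α + 1) {X : Finset V}
    {u y : V} (hX : PathBound α β ((X.erase y).erase u)) {r : V → PathRow V}
    (hr : ∀ v, (r v).IsValid) (hu : u ∈ X) (hy : y ∈ X) (huy : u ≠ y)
    (hiso : ∀ v ∈ X, v ≠ u → rowsWeight β r v (some u) = 0) :
    pathWeight (rowsWeight β r) (X.erase y) y ≤ (r y).capacity α β (X.erase y) *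
      ∏ v ∈ (X.erase y).erase u, vertexWeight α β r X v := by
  rw [pathWeight_erase (Finset.notMem_erase _ _) (Finset.mem_erase.2 ⟨huy, hu⟩)]
  · refine (hX r hr y (by simp)).trans ?_
    have hβα := (root_bounds hβ hα h).1.le
    refine mul_le_mul ((r y).capacity_mono hβ hβα (Finset.erase_subset _ _))
      (Finset.prod_le_prod (fun z _ => (vertexWeight_pos ..).le) fun z _ =>
        vertexWeight_mono hβ hα h r ((Finset.erase_subset _ _).trans (Finset.erase_subset _ _)) z)
      (zero_le_one.trans (one_le_prod_vertexWeight ..)) ((r y).capacity_nonneg hβ hβα _)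
  · intro v hv
    rw [Finset.insert_erase hy] at hv
    exact hiso v hv

end PathBound

/-- The walks inside `X` when the edges into `u` are light edges from the vertices in `N`, all of
which have a heavy edge as well. -/
theorem pathWeight_le_of_light_neighbors (hβ : 1 ≤ β) (hα : 0 < α) (h : α ^ 2 = β * α + 1)
    {X : Finset V} {s u : V} (hs : s ∉ X) (hu : u ∈ X) (hX : PathBound α β (X.erase u))
    (N : Finset V) (hN : N ⊆ (insert s X).erase u) (r : V → PathRow V) (hr : ∀ v, (r v).IsValid)
    (hiso : ∀ v ∈ insert s X, v ≠ u → v ∉ N → rowsWeight β r v (some u) = 0)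
    (hlight : ∀ v ∈ N, ∃ y ∈ X, y ≠ v ∧ y ≠ u ∧ r v = .edges (some y) (some u)) :
    pathWeight (rowsWeight β r) X s ≤ (∏ v ∈ insert s X, vertexWeight α β r X v) *
      (lossRatio α β ^ N.card * (1 / vertexWeight α β r X u + N.card / capWeight α β β)) := by
  have hρ := lossRatio_pos (β := β) hα
  have hsu : s ≠ u := fun e => hs (e ▸ hu)
  have hT : (insert s X).erase u = insert s (X.erase u) := Finset.erase_insert_of_ne hsu
  have huT : u ∈ insert s X := Finset.mem_insert_of_mem hu
  induction N using Finset.induction_on generalizing r with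
  | empty =>
    rw [pathWeight_erase hs hu (fun v hv hvu => hiso v hv hvu (Finset.notMem_empty v))]
    refine (hX.le_prod hβ hα h hr (fun hh => hs (Finset.mem_of_mem_erase hh))).trans ?_
    rw [← hT, ← Finset.mul_prod_erase _ _ huT]
    have hw := vertexWeight_pos α β r X u
    have : ∏ v ∈ (insert s X).erase u, vertexWeight α β r (X.erase u) v ≤
        ∏ v ∈ (insert s X).erase u, vertexWeight α β r X v :=
      Finset.prod_le_prod (fun z _ => (vertexWeight_pos ..).le) fun z _ =>
        vertexWeight_mono hβ hα h r (Finset.erase_subset _ _) z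
    refine this.trans_eq ?_
    simp only [Finset.card_empty, pow_zero, Nat.cast_zero, zero_div, add_zero]
    field_simp
  | insert v N hvN ih =>
    obtain ⟨y, hy, hyv, hyu, hv⟩ := hlight v (Finset.mem_insert_self _ _)
    have hvT := hN (Finset.mem_insert_self _ _)
    obtain ⟨hvu, hvT'⟩ := Finset.mem_erase.1 hvT
    have hrv : rowsWeight β r v = (PathRow.edges (some y) (some u)).weight β := by
      rw [rowsWeight, hv]
    -- Contraction of the edge from v to u: `r₁` cuts it and keeps the heavy edge of v, while in
    -- `r₂` the vertex v takes over the row of u.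
    set r₁ := Function.update r v (.edges (some y) none) with hr₁
    set r₂ := Function.update r v (r u) with hr₂
    have hr₁v : ∀ v, (r₁ v).IsValid := by
      intro z
      by_cases hz : z = v
      · subst hz; simp [hr₁, PathRow.IsValid]
      · simp [hr₁, hz, hr]
    have hr₂v : ∀ v, (r₂ v).IsValid := by
      intro z
      by_cases hz : z = v
      · subst hz; simp [hr₂, hr]
      · simp [hr₂, hz, hr]
    have e1 : Function.update (rowsWeight β r) v
        (Function.update (rowsWeight β r v) (some u) 0) = rowsWeight β r₁ := by
      rw [hr₁, rowsWeight_update]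
      congr 1
      rw [hrv]
      funext o
      rcases o with _ | z
      · simp [PathRow.weight]
      · by_cases hz : z = u
        · subst hz; simp [PathRow.weight, hyu]
        · simp [PathRow.weight, hz, Ne.symm hz]
    have e2 : Function.update (rowsWeight β r) v (rowsWeight β r u) = rowsWeight β r₂ := by
      rw [hr₂, rowsWeight_update]; rfl
    have e3 : rowsWeight β r v (some u) = 1 := by
      rw [hrv]; simp [PathRow.weight, hyu]
    have hcontr := pathWeight_contract (rowsWeight β r) hs hu hvu
    rw [e1, e2, e3, one_mul] at hcontr
    have hpos : 0 ≤ pathWeight (Function.update (rowsWeight β r) v 0) (X.erase u) s := by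
      refine pathWeight_nonneg (fun z o => ?_) _ _
      by_cases hz : z = v
      · subst hz; simp
      · simp [hz, rowsWeight_nonneg hβ]
    have hN' : N ⊆ (insert s X).erase u := (Finset.subset_insert _ _).trans hN
    have hvw : vertexWeight α β r X v = α := by
      have h1 : ∃ y_1 ∈ X.erase v, y = y_1 := ⟨y, Finset.mem_erase.2 ⟨hyv, hy⟩, rfl⟩
      have h2 : ∃ y_1 ∈ X.erase v, u = y_1 := ⟨u, Finset.mem_erase.2 ⟨hvu.symm, hu⟩, rfl⟩
      simp only [vertexWeight, hv, PathRow.capacity, Option.some.injEq, h1, h2, if_true]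
      exact capWeight_self hβ hα h
    have hvw1 : vertexWeight α β r₁ X v = lossRatio α β * α := by
      have h1 : ∃ y_1 ∈ X.erase v, y = y_1 := ⟨y, Finset.mem_erase.2 ⟨hyv, hy⟩, rfl⟩
      simp only [vertexWeight, hr₁, Function.update_self, PathRow.capacity, Option.some.injEq, h1,
        if_true, reduceCtorEq, and_false, exists_false, if_false]
      exact capWeight_beta_eq hβ hα h
    have hw1 : ∀ z, z ≠ v → ∀ Y, vertexWeight α β r₁ Y z = vertexWeight α β r Y z := by
      intro z hz Y
      simp [vertexWeight, hr₁, hz]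
    have hw2 : ∀ z, z ≠ v → ∀ Y, vertexWeight α β r₂ Y z = vertexWeight α β r Y z := by
      intro z hz Y
      simp [vertexWeight, hr₂, hz]
    -- the walks which avoid the edge from `v` to `u`
    have b1 := ih hN' r₁ hr₁v (by
        intro z hz hzu hzN
        by_cases hzv : z = v
        · subst hzv
          simp [rowsWeight, hr₁, PathRow.weight, hyu]
        · have := hiso z hz hzu (by simp [hzv, hzN])
          simpa [rowsWeight, hr₁, hzv] using this)
      (by
        intro z hz
        have hzv : z ≠ v := fun e => hvN (e ▸ hz)
        obtain ⟨x, hx, h1, h2, h3⟩ := hlight z (Finset.mem_insert_of_mem hz)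
        exact ⟨x, hx, h1, h2, by simp [hr₁, hzv, h3]⟩)
    have p1 : ∏ z ∈ insert s X, vertexWeight α β r₁ X z =
        lossRatio α β * ∏ z ∈ insert s X, vertexWeight α β r X z := by
      rw [← Finset.mul_prod_erase _ _ hvT', ← Finset.mul_prod_erase _ _ hvT', hvw, hvw1, mul_assoc]
      congr 2
      exact Finset.prod_congr rfl fun z hz => hw1 z (Finset.ne_of_mem_erase hz) X
    rw [p1, hw1 u hvu.symm] at b1
    -- the walks through the edge from `v` to `u`
    have b2 := hX.le_prod hβ hα h hr₂v (s := s) (fun hh => hs (Finset.mem_of_mem_erase hh))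
    rw [← hT, ← Finset.mul_prod_erase _ _ hvT] at b2
    have c1 : vertexWeight α β r₂ (X.erase u) v ≤ vertexWeight α β r X u := by
      simp only [vertexWeight, hr₂, Function.update_self]
      exact capWeight_mono hβ hα ((r u).capacity_mono hβ (root_bounds hβ hα h).1.le
        (Finset.erase_subset _ _))
    have c2 : ∏ z ∈ ((insert s X).erase u).erase v, vertexWeight α β r₂ (X.erase u) z ≤
        lossRatio α β ^ N.card *
          ∏ z ∈ ((insert s X).erase u).erase v, vertexWeight α β r X z := by
      have hsub : N ⊆ ((insert s X).erase u).erase v := fun z hz =>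
        Finset.mem_erase.2 ⟨fun e => hvN (e ▸ hz), hN' hz⟩
      refine Finset.prod_le_pow_card_mul hsub (fun z _ => (vertexWeight_pos ..).le) ?_ ?_
      · intro z hz
        rw [hw2 z (Finset.ne_of_mem_erase hz)]
        exact vertexWeight_mono hβ hα h r (Finset.erase_subset _ _) z
      · intro z hz
        rw [hw2 z (fun e => hvN (e ▸ hz))]
        obtain ⟨x, hx, h1, h2, h3⟩ := hlight z (Finset.mem_insert_of_mem hz)
        exact (vertexWeight_erase_light hβ hα h (hr z) hu
          (Finset.ne_of_mem_erase (hN' hz)) hx h1 h3).le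
    have p2 : ∏ z ∈ insert s X, vertexWeight α β r X z = vertexWeight α β r X u *
        (α * ∏ z ∈ ((insert s X).erase u).erase v, vertexWeight α β r X z) := by
      rw [← Finset.mul_prod_erase _ _ huT, ← Finset.mul_prod_erase _ _ hvT, hvw]
    have b3 : pathWeight (rowsWeight β r₂) (X.erase u) s ≤
        (∏ z ∈ insert s X, vertexWeight α β r X z) * (lossRatio α β ^ N.card / α) := by
      rw [p2]
      refine b2.trans ((mul_le_mul c1 c2 (Finset.prod_nonneg fun z _ => (vertexWeight_pos ..).le)
        (vertexWeight_pos ..).le).trans_eq ?_)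
      field_simp
    rw [hcontr, Finset.card_insert_of_notMem hvN]
    refine (add_le_add b1 ((sub_le_self _ hpos).trans b3)).trans_eq ?_
    -- With ρ = `lossRatio`, the merged walks contribute ρ^|N| / α = ρ^(|N|+1) / `capWeight α β β`,
    -- which is exactly one more summand of the sum.
    rw [capWeight_beta_eq hβ hα h]
    have := vertexWeight_pos α β r X u
    push_cast
    field_simp
    ring

end PathBoundInduction

/-! ### Induction step: isolated targets and a sole light in-neighbor. -/

section PathBoundStep

variable {V : Type*} [DecidableEq V] {α β : ℝ}

/-- The vertices of `X` with an edge to `u`. -/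
noncomputable def inNeighbors (β : ℝ) (r : V → PathRow V) (X : Finset V) (u : V) : Finset V :=
  open Classical in (X.erase u).filter fun v => rowsWeight β r v (some u) ≠ 0

theorem mem_inNeighbors {r : V → PathRow V} {X : Finset V} {u v : V} :
    v ∈ inNeighbors β r X u ↔ v ∈ X.erase u ∧ rowsWeight β r v (some u) ≠ 0 := by
  classical
  simp [inNeighbors]

theorem inNeighbors_subset (r : V → PathRow V) (X : Finset V) (u : V) :
    inNeighbors β r X u ⊆ X.erase u := fun _ hv => (mem_inNeighbors.1 hv).1

theorem edges_of_mem_inNeighbors {r : V → PathRow V} {X : Finset V} {u v : V}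
    (hv : v ∈ inNeighbors β r X u) : ∃ a b, r v = .edges a b ∧ (a = some u ∨ b = some u) :=
  PathRow.weight_ne_zero (mem_inNeighbors.1 hv).2

theorem rowsWeight_eq_zero_of_inNeighbors {r : V → PathRow V} {X : Finset V} {u v : V}
    (hv : v ∈ X) (hvu : v ≠ u) (h : v ∉ inNeighbors β r X u) :
    rowsWeight β r v (some u) = 0 := by
  by_contra H
  exact h (mem_inNeighbors.2 ⟨Finset.mem_erase.2 ⟨hvu, hv⟩, H⟩)

variable {X : Finset V} {u w : V} {r : V → PathRow V}

/-- The weights of the two branches when the heavy target has no other incoming edges. -/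
theorem step_of_heavy_isolated (hβ : 1 ≤ β) (hα : 0 < α) (h : α ^ 2 = β * α + 1)
    (ih : ∀ Y ⊂ X, PathBound α β Y) (hr : ∀ v, (r v).IsValid)
    (hu : u ∈ X) (hw : w ∈ X) (huw : u ≠ w) (hN : inNeighbors β r X u = ∅) :
    β * pathWeight (rowsWeight β r) (X.erase u) u + pathWeight (rowsWeight β r) (X.erase w) w ≤
      α * ∏ v ∈ X, vertexWeight α β r X v := by
  have b1 := (ih _ (Finset.erase_ssubset hu)).branch_le hβ hα h hr (N := ∅) (c := 0)
    (Finset.empty_subset _) (by simp)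
  have b2 := (ih ((X.erase w).erase u) ((Finset.erase_subset _ _).trans_ssubset
    (Finset.erase_ssubset hw))).branch_le_of_isolated hβ hα h hr hu hw huw
    (fun v hv hvu => rowsWeight_eq_zero_of_inNeighbors hv hvu (by simp [hN]))
  rw [Finset.prod_empty, one_mul] at b1
  have b3 : pathWeight (rowsWeight β r) (X.erase w) w ≤
      ∏ v ∈ X.erase u, vertexWeight α β r X v := by
    rw [Finset.erase_right_comm] at b2
    rw [← Finset.mul_prod_erase (X.erase u) _ (Finset.mem_erase.2 ⟨huw.symm, hw⟩)]
    refine b2.trans (mul_le_mul_of_nonneg_right (capacity_le_vertexWeight hβ hα h r X w)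
      (zero_le_one.trans (one_le_prod_vertexWeight ..)))
  have hK := one_le_prod_vertexWeight α β r X (X.erase u)
  rw [← Finset.mul_prod_erase X _ hu, ← mul_assoc]
  -- The walks from w never meet u, so u is missing from their product; what is left is the
  -- inequality for which `capWeight` is defined.
  have h3 := le_mul_capWeight (β := β) hα ((r u).capacity α β (X.erase u))
  calc _ ≤ β * ((r u).capacity α β (X.erase u) * ∏ v ∈ X.erase u, vertexWeight α β r X v) +
        ∏ v ∈ X.erase u, vertexWeight α β r X v := by gcongr
    _ = (β * (r u).capacity α β (X.erase u) + 1) *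
        ∏ v ∈ X.erase u, vertexWeight α β r X v := by ring
    _ ≤ _ := by gcongr; exact h3

/-- The weights of the two branches when the light target has no other incoming edges. -/
theorem step_le_of_light_isolated (hβ : 1 ≤ β) (hα : 0 < α) (h : α ^ 2 = β * α + 1)
    (ih : ∀ Y ⊂ X, PathBound α β Y) (hr : ∀ v, (r v).IsValid)
    (hu : u ∈ X) (hw : w ∈ X) (huw : u ≠ w) (hN : inNeighbors β r X w = ∅) :
    β * pathWeight (rowsWeight β r) (X.erase u) u + pathWeight (rowsWeight β r) (X.erase w) w ≤
      (β + (r w).capacity α β (X.erase w)) * ∏ v ∈ X.erase w, vertexWeight α β r X v := by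
  have b1 := (ih _ (Finset.erase_ssubset hw)).branch_le hβ hα h hr (N := ∅) (c := 0)
    (Finset.empty_subset _) (by simp)
  have b2 := (ih ((X.erase u).erase w) ((Finset.erase_subset _ _).trans_ssubset
    (Finset.erase_ssubset hu))).branch_le_of_isolated hβ hα h hr hw hu huw.symm
    (fun v hv hvu => rowsWeight_eq_zero_of_inNeighbors hv hvu (by simp [hN]))
  rw [Finset.prod_empty, one_mul] at b1
  have b3 : pathWeight (rowsWeight β r) (X.erase u) u ≤
      ∏ v ∈ X.erase w, vertexWeight α β r X v := by
    rw [Finset.erase_right_comm] at b2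
    rw [← Finset.mul_prod_erase (X.erase w) _ (Finset.mem_erase.2 ⟨huw, hu⟩)]
    refine b2.trans (mul_le_mul_of_nonneg_right (capacity_le_vertexWeight hβ hα h r X u)
      (zero_le_one.trans (one_le_prod_vertexWeight ..)))
  have : β * pathWeight (rowsWeight β r) (X.erase u) u ≤
      β * ∏ v ∈ X.erase w, vertexWeight α β r X v := by gcongr
  linarith

theorem step_of_light_isolated (hβ : 1 ≤ β) (hα : 0 < α) (h : α ^ 2 = β * α + 1)
    (ih : ∀ Y ⊂ X, PathBound α β Y) (hr : ∀ v, (r v).IsValid)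
    (hu : u ∈ X) (hw : w ∈ X) (huw : u ≠ w) (hN : inNeighbors β r X w = ∅) :
    β * pathWeight (rowsWeight β r) (X.erase u) u + pathWeight (rowsWeight β r) (X.erase w) w ≤
      α * ∏ v ∈ X, vertexWeight α β r X v := by
  refine (step_le_of_light_isolated hβ hα h ih hr hu hw huw hN).trans ?_
  have hK := one_le_prod_vertexWeight α β r X (X.erase w)
  rw [← Finset.mul_prod_erase X _ hw, ← mul_assoc]
  gcongr
  exact add_le_mul_capWeight hβ hα h
    ((r w).capacity_eq_zero_or hβ (root_bounds hβ hα h).1.le (X.erase w))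

/-- If the only edge into `u` comes from a vertex `v` without other edges, then `u` can be merged
into `v`. -/
theorem pathWeight_le_of_sole_light_neighbor (hβ : 1 ≤ β) (hα : 0 < α) (h : α ^ 2 = β * α + 1)
    (ih : ∀ Y ⊂ X, PathBound α β Y) (hr : ∀ v, (r v).IsValid)
    (hu : u ∈ X) (hw : w ∈ X) (huw : u ≠ w) {v : V} (hN : inNeighbors β r X u = {v})
    {a : Option V} (ha : ¬ ∃ y ∈ X.erase v, a = some y) (hv : r v = .edges a (some u)) :
    pathWeight (rowsWeight β r) (X.erase w) w ≤
      α / (β + 1) * ∏ z ∈ X, vertexWeight α β r X z := by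
  have hvN : v ∈ inNeighbors β r X u := by simp [hN]
  have hvX := inNeighbors_subset r X u hvN
  obtain ⟨hvu, hvX'⟩ := Finset.mem_erase.1 hvX
  have hau : a ≠ some u := fun e => ha ⟨u, Finset.mem_erase.2 ⟨hvu.symm, hu⟩, e⟩
  have hrv : rowsWeight β r v = (PathRow.edges a (some u)).weight β := by rw [rowsWeight, hv]
  have huX : u ∈ X.erase w := Finset.mem_erase.2 ⟨huw, hu⟩
  set r₂ := Function.update r v (r u) with hr₂
  have hr₂v : ∀ v, (r₂ v).IsValid := by
    intro z
    by_cases hz : z = v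
    · subst hz; simp [hr₂, hr]
    · simp [hr₂, hz, hr]
  -- Once the edge to u is cut, v is a dead end and u has no incoming edges. So the walks that avoid
  -- the edge cancel the subtracted term of the contraction formula, and only the merged graph
  -- remains.
  have e1 : pathWeight (Function.update (rowsWeight β r) v
      (Function.update (rowsWeight β r v) (some u) 0)) (X.erase w) w =
      pathWeight (Function.update (rowsWeight β r) v 0) ((X.erase w).erase u) w := by
    rw [← pathWeight_erase (Finset.notMem_erase _ _) huX]
    · refine pathWeight_congr (Finset.notMem_erase _ _) fun z hz => ?_
      by_cases hzv : z = v
      · subst hzv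
        refine ⟨by simp [hrv, PathRow.weight], fun y hy hyz => ?_⟩
        have : a ≠ some y := fun e =>
          ha ⟨y, Finset.mem_erase.2 ⟨hyz, Finset.mem_of_mem_erase hy⟩, e⟩
        by_cases hyu : y = u
        · simp [hyu]
        · simp [hrv, PathRow.weight, this, hyu, Ne.symm hyu]
      · simp [hzv]
    · intro z hz hzu
      rw [Finset.insert_erase hw] at hz
      by_cases hzv : z = v
      · simp [hzv]
      · simpa [hzv] using rowsWeight_eq_zero_of_inNeighbors (β := β) (r := r) hz hzu
          (by simp [hN, hzv])
  have e2 : Function.update (rowsWeight β r) v (rowsWeight β r u) = rowsWeight β r₂ := by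
    rw [hr₂, rowsWeight_update]; rfl
  have e3 : rowsWeight β r v (some u) = 1 := by
    rw [hrv]; simp [PathRow.weight, hau]
  rw [pathWeight_contract (rowsWeight β r) (Finset.notMem_erase _ _) huX hvu, e1, e2, e3, one_mul,
    add_sub_cancel]
  have b := (ih ((X.erase w).erase u) ((Finset.erase_subset _ _).trans_ssubset
    (Finset.erase_ssubset hw))).le_prod hβ hα h hr₂v (s := w) (by simp)
  refine b.trans ?_
  have hT : insert w ((X.erase w).erase u) = X.erase u := by
    rw [Finset.erase_right_comm, Finset.insert_erase (Finset.mem_erase.2 ⟨huw.symm, hw⟩)]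
  have hsub : (X.erase w).erase u ⊆ X := (Finset.erase_subset _ _).trans (Finset.erase_subset _ _)
  -- The merged vertex is charged to u, so the weight of v is saved; its inverse is the claimed
  -- factor.
  have hvw : vertexWeight α β r X v = (β + 1) / α := by
    have h2 : ∃ y ∈ X.erase v, some u = some y := ⟨u, Finset.mem_erase.2 ⟨hvu.symm, hu⟩, rfl⟩
    rw [vertexWeight, hv, PathRow.capacity, if_neg ha, if_pos h2, capWeight_one hβ hα h]
  rw [hT, ← Finset.mul_prod_erase _ _ hvX, ← Finset.mul_prod_erase X _ hu,
    ← Finset.mul_prod_erase (X.erase u) _ hvX, hvw]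
  have c1 : vertexWeight α β r₂ ((X.erase w).erase u) v ≤ vertexWeight α β r X u := by
    simp only [vertexWeight, hr₂, Function.update_self]
    refine capWeight_mono hβ hα ((r u).capacity_mono hβ (root_bounds hβ hα h).1.le ?_)
    exact (Finset.erase_subset _ _).trans (Finset.erase_subset_erase _ (Finset.erase_subset _ _))
  have c2 : ∏ z ∈ (X.erase u).erase v, vertexWeight α β r₂ ((X.erase w).erase u) z ≤
      ∏ z ∈ (X.erase u).erase v, vertexWeight α β r X z := by
    refine Finset.prod_le_prod (fun z _ => (vertexWeight_pos ..).le) fun z hz => ?_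
    have : vertexWeight α β r₂ ((X.erase w).erase u) z =
        vertexWeight α β r ((X.erase w).erase u) z := by
      simp [vertexWeight, hr₂, Finset.ne_of_mem_erase hz]
    rw [this]
    exact vertexWeight_mono hβ hα h r hsub z
  refine (mul_le_mul c1 c2 (Finset.prod_nonneg fun z _ => (vertexWeight_pos ..).le)
    (vertexWeight_pos ..).le).trans_eq ?_
  field_simp

end PathBoundStep

/-! ### Induction step: only light edges enter the two targets. -/

section PathBoundMain

variable {V : Type*} [DecidableEq V] {α β : ℝ} {X : Finset V} {u w : V} {r : V → PathRow V}

theorem pathWeight_of_edges {s : V} {a b : Option V} (hs : r s = .edges a b) (Y : Finset V) :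
    pathWeight (rowsWeight β r) Y s =
      ∑ y ∈ Y, (if a = some y then β * pathWeight (rowsWeight β r) (Y.erase y) y else 0) +
      ∑ y ∈ Y, (if b = some y then pathWeight (rowsWeight β r) (Y.erase y) y else 0) := by
  rw [pathWeight_eq, ← Finset.sum_add_distrib]
  have h0 : rowsWeight β r s none = 0 := by rw [rowsWeight, hs]; rfl
  rw [h0, zero_add]
  refine Finset.sum_congr rfl fun y _ => ?_
  have h1 : rowsWeight β r s (some y) =
      (if a = some y then β else 0) + (if b = some y then 1 else 0) := by
    rw [rowsWeight, hs]; rfl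
  rw [h1, add_mul]
  split_ifs <;> simp

theorem Finset.sum_ite_some_eq {Y : Finset V} {y : V} (hy : y ∈ Y) (f : V → ℝ) :
    ∑ z ∈ Y, (if some y = some z then f z else 0) = f y := by
  simp [hy]

theorem Finset.sum_ite_some_eq_zero {Y : Finset V} {a : Option V} (ha : ¬ ∃ y ∈ Y, a = some y)
    (f : V → ℝ) : ∑ z ∈ Y, (if a = some z then f z else 0) = 0 :=
  Finset.sum_eq_zero fun z hz => if_neg fun e => ha ⟨z, hz, e⟩

/-- The weights of the two branches when both targets have other incoming edges, all these edges
are light, and the vertices with an edge to the heavy target have a heavy edge as well. -/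
theorem step_of_light_neighbors (hβ : 2 ≤ β) (hα : 0 < α) (h : α ^ 2 = β * α + 1)
    (ih : ∀ Y ⊂ X, PathBound α β Y) (hr : ∀ v, (r v).IsValid)
    (hu : u ∈ X) (hw : w ∈ X) (huw : u ≠ w)
    (hNu : (inNeighbors β r X u).Nonempty) (hNw : (inNeighbors β r X w).Nonempty)
    (hU : ∀ v ∈ inNeighbors β r X u, ∃ y ∈ X.erase v, y ≠ u ∧ r v = .edges (some y) (some u))
    (hW : ∀ v ∈ inNeighbors β r X w, ∃ a, a ≠ some w ∧ r v = .edges a (some w)) :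
    β * pathWeight (rowsWeight β r) (X.erase u) u + pathWeight (rowsWeight β r) (X.erase w) w ≤
      α * ∏ v ∈ X, vertexWeight α β r X v := by
  have hβ1 : 1 ≤ β := by linarith
  have hβα := (root_bounds hβ1 hα h).1.le
  have hρ := lossRatio_pos (β := β) hα
  have hρ1 := lossRatio_le_one hβ1 hα h
  have hBpos : 0 < capWeight α β β := zero_lt_one.trans_le (one_le_capWeight _)
  have hmax : max (lossRatio α β) (α / (β + 1)) = lossRatio α β :=
    max_eq_left (inv_capWeight_one_le hβ hα h)
  have hwX : w ∈ X.erase u := Finset.mem_erase.2 ⟨huw.symm, hw⟩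
  have huX : u ∈ X.erase w := Finset.mem_erase.2 ⟨huw, hu⟩
  obtain ⟨j, hj⟩ : ∃ j, (inNeighbors β r X u).card = j + 1 :=
    Nat.exists_eq_succ_of_ne_zero (Finset.card_pos.2 hNu).ne'
  set K := ∏ v ∈ X.erase u, vertexWeight α β r X v with hK
  have hK1 : 1 ≤ K := one_le_prod_vertexWeight ..
  have hRK : ∏ v ∈ X, vertexWeight α β r X v = vertexWeight α β r X u * K :=
    (Finset.mul_prod_erase X _ hu).symm
  have hwu := vertexWeight_pos α β r X u
  have hwu' := vertexWeight_pos α β r (X.erase w) u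
  have hNuX : ∀ v ∈ inNeighbors β r X u, v ≠ u := fun v hv =>
    Finset.ne_of_mem_erase (inNeighbors_subset r X u hv)
  -- the branch through `u`
  have bu : pathWeight (rowsWeight β r) (X.erase u) u ≤
      (r u).capacity α β (X.erase u) * (lossRatio α β ^ (j + 1) * K) := by
    have := (ih _ (Finset.erase_ssubset hu)).branch_le hβ1 hα h hr (N := inNeighbors β r X u)
      (c := fun _ => lossRatio α β) (inNeighbors_subset _ _ _) (by
        intro v hv
        obtain ⟨y, hy, -, hv'⟩ := hU v hv
        exact (vertexWeight_erase_light hβ1 hα h (hr v) hu (hNuX v hv)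
          (Finset.mem_of_mem_erase hy) (Finset.ne_of_mem_erase hy) hv').le)
    rwa [Finset.prod_const, hj] at this
  -- the branch through `w`
  have hheavy : ∀ v ∈ inNeighbors β r X u, ∃ y ∈ X.erase w,
      y ≠ v ∧ y ≠ u ∧ r v = .edges (some y) (some u) := by
    intro v hv
    obtain ⟨y, hy, hyu, hv'⟩ := hU v hv
    obtain ⟨hyv, hyX⟩ := Finset.mem_erase.1 hy
    refine ⟨y, Finset.mem_erase.2 ⟨?_, hyX⟩, hyv, hyu, hv'⟩
    -- A heavy target equal to w would give w an incoming heavy edge, so the heavy edges of these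
    -- vertices survive the deletion of w.
    rintro rfl
    obtain ⟨a, ha, e⟩ := hW v (mem_inNeighbors.2 ⟨Finset.mem_erase.2 ⟨hyv.symm,
      Finset.mem_of_mem_erase (inNeighbors_subset r X u hv)⟩, by
        rw [rowsWeight, hv', PathRow.weight, if_pos rfl]
        split_ifs <;> linarith⟩)
    rw [hv'] at e
    injection e with e1 e2
    exact ha e1.symm
  have hins : insert w (X.erase w) = X := Finset.insert_erase hw
  have bw : pathWeight (rowsWeight β r) (X.erase w) w ≤
      (∏ v ∈ X, vertexWeight α β r (X.erase w) v) * (lossRatio α β ^ (j + 1) *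
        (1 / vertexWeight α β r (X.erase w) u + (j + 1) / capWeight α β β)) := by
    have := pathWeight_le_of_light_neighbors hβ1 hα h (Finset.notMem_erase w X) huX
      (ih _ ((Finset.erase_subset _ _).trans_ssubset (Finset.erase_ssubset hw)))
      (inNeighbors β r X u) (by rw [hins]; exact inNeighbors_subset _ _ _) r hr
      (by rw [hins]; exact fun v hv hvu hvN => rowsWeight_eq_zero_of_inNeighbors hv hvu hvN) hheavy
    rwa [hins, hj, Nat.cast_add_one] at this
  have hsplit : ∏ v ∈ X, vertexWeight α β r (X.erase w) v = vertexWeight α β r (X.erase w) u *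
      ∏ v ∈ X.erase u, vertexWeight α β r (X.erase w) v := (Finset.mul_prod_erase X _ hu).symm
  have hmono : ∀ v, vertexWeight α β r (X.erase w) v ≤ vertexWeight α β r X v := fun v =>
    vertexWeight_mono hβ1 hα h r (Finset.erase_subset _ _) v
  have hK' : ∏ v ∈ X.erase u, vertexWeight α β r (X.erase w) v ≤ K :=
    Finset.prod_le_prod (fun v _ => (vertexWeight_pos ..).le) fun v _ => hmono v
  have hbu := mul_le_mul_of_nonneg_left bu (by linarith : 0 ≤ β)
  -- An in-neighbor of w other than u gives the branch through w a further factor `lossRatio`.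
  -- Otherwise the light edge of u is the only edge into w inside X.
  by_cases hx : ∃ x ∈ inNeighbors β r X w, x ≠ u
  · obtain ⟨x, hx, hxu⟩ := hx
    obtain ⟨hxw, hxX⟩ := Finset.mem_erase.1 (inNeighbors_subset r X w hx)
    have hK'' : ∏ v ∈ X.erase u, vertexWeight α β r (X.erase w) v ≤ lossRatio α β * K := by
      have := Finset.prod_le_pow_card_mul (T := X.erase u) (N := {x})
        (f := vertexWeight α β r (X.erase w)) (g := vertexWeight α β r X) (c := lossRatio α β)
        (by simpa using ⟨hxu, hxX⟩) (fun v _ => (vertexWeight_pos ..).le) (fun v _ => hmono v)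
        (by
          simp only [Finset.mem_singleton, forall_eq]
          rw [← hmax]
          exact vertexWeight_erase_le hβ1 hα h (hr x) hw hxw (mem_inNeighbors.1 hx).2)
      simpa using this
    have key := light_neighbors_bound hβ1 hα h ((r u).capacity_le hβ1 hβα (X.erase u)) j
    change β * (_ * _ / vertexWeight α β r X u) + _ *
      (_ * (1 / vertexWeight α β r X u + _)) ≤ α at key
    have bw' : pathWeight (rowsWeight β r) (X.erase w) w ≤ lossRatio α β *
        (lossRatio α β ^ (j + 1) * (1 / vertexWeight α β r X u + (j + 1) / capWeight α β β)) *
          (vertexWeight α β r X u * K) := by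
      refine bw.trans ?_
      rw [hsplit]
      calc _ = (∏ v ∈ X.erase u, vertexWeight α β r (X.erase w) v) * (lossRatio α β ^ (j + 1) *
            (1 + (j + 1) * vertexWeight α β r (X.erase w) u / capWeight α β β)) := by
            field_simp
        _ ≤ lossRatio α β * K * (lossRatio α β ^ (j + 1) *
            (1 + (j + 1) * vertexWeight α β r X u / capWeight α β β)) := by
            gcongr
            exact hmono u
        _ = _ := by field_simp
    rw [hRK]
    have hR : 0 ≤ vertexWeight α β r X u * K := by positivity
    refine le_trans (add_le_add hbu bw') (le_trans (le_of_eq ?_)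
      (mul_le_mul_of_nonneg_right key hR))
    field_simp
  push Not at hx
  have huN : u ∈ inNeighbors β r X w := by
    obtain ⟨x, hxN⟩ := hNw
    exact hx x hxN ▸ hxN
  obtain ⟨a, haw, hru⟩ := hW u huN
  by_cases hau : ∃ y ∈ X.erase u, a = some y
  swap
  -- If u has no heavy edge, deleting w reduces the weight of u to 1, so both branches are at most
  -- K, and (β + 1) K = α w(u) K.
  · have e1 : vertexWeight α β r (X.erase w) u = α / (β + 1) * vertexWeight α β r X u :=
      vertexWeight_erase_light_only hβ1 hα h hw huw hau hru
    have hlw : ∃ y ∈ X.erase u, some w = some y := ⟨w, hwX, rfl⟩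
    have e2 : (r u).capacity α β (X.erase u) = 1 := by
      rw [hru, PathRow.capacity, if_neg hau, if_pos hlw]
    have e3 : vertexWeight α β r X u = (β + 1) / α := by
      rw [vertexWeight, e2, capWeight_one hβ1 hα h]
    have b2 := (ih _ (Finset.erase_ssubset hw)).le_prod hβ1 hα h hr (Finset.notMem_erase w X)
    rw [hins, hsplit, e1, e3] at b2
    have e4 : α / (β + 1) * ((β + 1) / α) = 1 := by field_simp
    rw [e4, one_mul] at b2
    rw [e2, one_mul] at hbu
    have hp : lossRatio α β ^ (j + 1) ≤ 1 := pow_le_one₀ hρ.le hρ1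
    have : lossRatio α β ^ (j + 1) * K ≤ 1 * K := by gcongr
    rw [hRK, e3, ← mul_assoc, mul_div_cancel₀ _ hα.ne']
    nlinarith
  obtain ⟨x, hxu, rfl⟩ := hau
  have hxw : x ≠ w := fun e => haw (by rw [e])
  obtain ⟨hxu', hxX⟩ := Finset.mem_erase.1 hxu
  have ecap : (r u).capacity α β (X.erase u) = α := by
    rw [hru, PathRow.capacity, if_pos ⟨x, hxu, rfl⟩, if_pos ⟨w, hwX, rfl⟩]
  have ewu : vertexWeight α β r X u = α := by rw [vertexWeight, ecap, capWeight_self hβ1 hα h]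
  have ewu' : vertexWeight α β r (X.erase w) u = capWeight α β β := by
    rw [vertexWeight_erase_light hβ1 hα h (hr u) hw huw hxX hxu' hru, ewu,
      capWeight_beta_eq hβ1 hα h]
  rw [ecap] at hbu
  rw [hRK, ewu, ← mul_assoc, ← pow_two]
  have hp : lossRatio α β ^ (j + 1) ≤ 1 := pow_le_one₀ hρ.le hρ1
  -- when the weight of the walks from `w` is at most `K`
  have hsmall : pathWeight (rowsWeight β r) (X.erase w) w ≤ K →
      β * pathWeight (rowsWeight β r) (X.erase u) u + pathWeight (rowsWeight β r) (X.erase w) w ≤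
        α ^ 2 * K := by
    intro hle
    have : β * (α * (lossRatio α β ^ (j + 1) * K)) ≤ β * (α * (1 * K)) := by gcongr
    nlinarith
  rcases hrw : r w with _ | ⟨c, d⟩
  · apply hsmall
    refine le_trans (le_of_eq ?_) hK1
    rw [pathWeight_eq, rowsWeight, hrw]
    simp [PathRow.weight]
  by_cases hc : ∃ y ∈ X.erase w, c = some y
  · -- `w` has a heavy edge
    have hq : β ≤ (r w).capacity α β (X.erase w) := by
      rw [hrw, PathRow.capacity, if_pos hc]
      split_ifs <;> linarith
    -- The branch through u is expanded by one more edge, to x or w. After the deletion of u nothing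
    -- enters w, so the bound for an isolated light target applies.
    have hP : pathWeight (rowsWeight β r) (X.erase u) u ≤
        (β + (r w).capacity α β (X.erase w)) *
          (lossRatio α β ^ j * ∏ v ∈ (X.erase u).erase w, vertexWeight α β r X v) := by
      rw [pathWeight_of_edges hru,
        Finset.sum_ite_some_eq hxu fun y => β * pathWeight (rowsWeight β r) ((X.erase u).erase y) y,
        Finset.sum_ite_some_eq hwX]
      have hss : X.erase u ⊂ X := Finset.erase_ssubset hu
      refine (step_le_of_light_isolated hβ1 hα h (fun Y hY => ih Y (hY.trans hss)) hr hxu hwX hxw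
        ?_).trans ?_
      · rw [Finset.eq_empty_iff_forall_notMem]
        intro v hv
        obtain ⟨h1, h2⟩ := mem_inNeighbors.1 hv
        obtain ⟨h3, h4⟩ := Finset.mem_erase.1 h1
        exact Finset.ne_of_mem_erase h4 (hx v (mem_inNeighbors.2
          ⟨Finset.mem_erase.2 ⟨h3, Finset.mem_of_mem_erase h4⟩, h2⟩))
      · have hsub : (inNeighbors β r X u).erase w ⊆ (X.erase u).erase w :=
          Finset.erase_subset_erase _ (inNeighbors_subset _ _ _)
        have h1 := Finset.prod_le_pow_card_mul hsub (f := vertexWeight α β r (X.erase u))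
          (g := vertexWeight α β r X) (c := lossRatio α β) (fun v _ => (vertexWeight_pos ..).le)
          (fun v _ => vertexWeight_mono hβ1 hα h r (Finset.erase_subset _ _) v)
          (by
            intro v hv
            have hv' := Finset.mem_of_mem_erase hv
            obtain ⟨y, hy, -, hv''⟩ := hU v hv'
            exact (vertexWeight_erase_light hβ1 hα h (hr v) hu (hNuX v hv')
              (Finset.mem_of_mem_erase hy) (Finset.ne_of_mem_erase hy) hv'').le)
        -- The vertex w may be an in-neighbor of u, but it is no longer in the product, so one
        -- factor may be lost.
        have h2 : lossRatio α β ^ ((inNeighbors β r X u).erase w).card ≤ lossRatio α β ^ j := by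
          refine pow_le_pow_of_le_one hρ.le hρ1 ?_
          have := Finset.pred_card_le_card_erase (s := inNeighbors β r X u) (a := w)
          omega
        have h3 : 0 ≤ ∏ v ∈ (X.erase u).erase w, vertexWeight α β r X v :=
          zero_le_one.trans (one_le_prod_vertexWeight ..)
        have h4 : (r w).capacity α β ((X.erase u).erase w) ≤ (r w).capacity α β (X.erase w) :=
          (r w).capacity_mono hβ1 hβα (Finset.erase_subset_erase _ (Finset.erase_subset _ _))
        have h5 := (r w).capacity_nonneg hβ1 hβα ((X.erase u).erase w)
        refine mul_le_mul (by linarith) (h1.trans (mul_le_mul_of_nonneg_right h2 h3))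
          (zero_le_one.trans (one_le_prod_vertexWeight ..)) (by linarith)
    have hP' : pathWeight (rowsWeight β r) (X.erase u) u ≤
        2 * α * β / (β ^ 2 + 1) * lossRatio α β ^ j * K := by
      refine hP.trans ?_
      have h1 := add_mul_le_capWeight hβ1 hα h hq
      have h3 : 0 ≤ ∏ v ∈ (X.erase u).erase w, vertexWeight α β r X v :=
        zero_le_one.trans (one_le_prod_vertexWeight ..)
      have h4 : K = capWeight α β ((r w).capacity α β (X.erase w)) *
          ∏ v ∈ (X.erase u).erase w, vertexWeight α β r X v :=
        (Finset.mul_prod_erase (X.erase u) _ hwX).symm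
      rw [h4]
      calc _ ≤ 2 * α * β / (β ^ 2 + 1) * capWeight α β ((r w).capacity α β (X.erase w)) *
            (lossRatio α β ^ j * ∏ v ∈ (X.erase u).erase w, vertexWeight α β r X v) := by
            gcongr
        _ = _ := by ring
    have bw' : pathWeight (rowsWeight β r) (X.erase w) w ≤
        lossRatio α β ^ (j + 1) * (1 + (j + 1)) * K := by
      refine bw.trans ?_
      rw [hsplit, ewu']
      calc _ = (∏ v ∈ X.erase u, vertexWeight α β r (X.erase w) v) *
            (lossRatio α β ^ (j + 1) * (1 + (j + 1))) := by field_simp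
        _ ≤ K * (lossRatio α β ^ (j + 1) * (1 + (j + 1))) := by gcongr
        _ = _ := by ring
    have key := mul_le_mul_of_nonneg_right (shared_target_bound hβ hα h j)
      (zero_le_one.trans hK1)
    refine le_trans (add_le_add (mul_le_mul_of_nonneg_left hP' (by linarith : 0 ≤ β)) bw')
      (le_trans (le_of_eq ?_) key)
    ring
  by_cases hd : ∃ y ∈ X.erase w, d = some y
  swap
  · -- `w` has no edges
    apply hsmall
    refine le_trans (le_of_eq ?_) (zero_le_one.trans hK1)
    rw [pathWeight_of_edges hrw,
      Finset.sum_ite_some_eq_zero hc fun y => β * pathWeight (rowsWeight β r) ((X.erase w).erase y) y,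
      Finset.sum_ite_some_eq_zero hd, add_zero]
  -- `w` has only a light edge, which is compared to a heavy edge
  obtain ⟨b, hbw, rfl⟩ := hd
  have hwN : w ∉ inNeighbors β r X u := by
    intro hwN
    obtain ⟨y, hy, -, e⟩ := hU w hwN
    rw [hrw] at e
    injection e with e1 e2
    exact hc ⟨y, hy, e1⟩
  have hbu' : b ≠ u := by
    rintro rfl
    exact hwN (mem_inNeighbors.2 ⟨hwX, by
      rw [rowsWeight, hrw, PathRow.weight, if_pos rfl]
      split_ifs <;> linarith⟩)
  -- Replacing the light edge of w by a heavy edge to b multiplies the walks from w by β; the bound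
  -- grows only by the ratio of the weights for capacities β and 1, which is (β² + 1)/(β + 1).
  set r' := Function.update r w (.edges (some b) none) with hr'
  have hr'v : ∀ v, (r' v).IsValid := by
    intro z
    by_cases hz : z = w
    · subst hz; simp [hr', PathRow.IsValid]
    · simp [hr', hz, hr]
  have hwt : ∀ z, z ≠ w → ∀ Y, vertexWeight α β r' Y z = vertexWeight α β r Y z := by
    intro z hz Y
    simp [vertexWeight, hr', hz]
  have hrw' : r' w = .edges (some b) none := by simp [hr']
  have hscale : pathWeight (rowsWeight β r') (X.erase w) w =
      β * pathWeight (rowsWeight β r) (X.erase w) w := by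
    have h1 : pathWeight (rowsWeight β r') ((X.erase w).erase b) b =
        pathWeight (rowsWeight β r) ((X.erase w).erase b) b := by
      rw [hr', rowsWeight_update, pathWeight_update_of_notMem _ (Finset.notMem_erase _ _)]
      rw [Finset.insert_erase hbw]
      exact Finset.notMem_erase _ _
    rw [pathWeight_of_edges hrw, pathWeight_of_edges hrw',
      Finset.sum_ite_some_eq_zero hc fun y => β * pathWeight (rowsWeight β r) ((X.erase w).erase y) y,
      Finset.sum_ite_some_eq hbw, Finset.sum_ite_some_eq hbw, h1]
    simp
  have b3 := pathWeight_le_of_light_neighbors hβ1 hα h (Finset.notMem_erase w X) huX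
    (ih _ ((Finset.erase_subset _ _).trans_ssubset (Finset.erase_ssubset hw)))
    (inNeighbors β r X u) (by rw [hins]; exact inNeighbors_subset _ _ _) r' hr'v
    (by
      rw [hins]
      intro v hv hvu hvN
      by_cases hvw : v = w
      · subst hvw
        rw [rowsWeight, hrw']
        simp [PathRow.weight, hbu']
      · have := rowsWeight_eq_zero_of_inNeighbors hv hvu hvN
        rwa [rowsWeight, ← Function.update_of_ne hvw (PathRow.edges (some b) none) r] at this)
    (by
      intro v hv
      obtain ⟨y, h1, h2, h3, h4⟩ := hheavy v hv
      have hvw : v ≠ w := fun e => hwN (e ▸ hv)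
      exact ⟨y, h1, h2, h3, by simp [hr', hvw, h4]⟩)
  rw [hscale, hins, hj, Nat.cast_add_one, hwt u huw, ewu'] at b3
  have e5 : vertexWeight α β r' (X.erase w) w = capWeight α β β := by
    rw [vertexWeight, hrw', PathRow.capacity, Finset.erase_idem, if_pos ⟨b, hbw, rfl⟩]
    simp
  have e6 : vertexWeight α β r X w = (β + 1) / α := by
    rw [vertexWeight, hrw, PathRow.capacity, if_neg hc, if_pos ⟨b, hbw, rfl⟩,
      capWeight_one hβ1 hα h]
  have e7 : ∏ v ∈ X, vertexWeight α β r' (X.erase w) v = capWeight α β β *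
      (capWeight α β β * ∏ v ∈ (X.erase u).erase w, vertexWeight α β r (X.erase w) v) := by
    rw [← Finset.mul_prod_erase X _ hu, ← Finset.mul_prod_erase (X.erase u) _ hwX, e5,
      hwt u huw, ewu']
    congr 2
    exact Finset.prod_congr rfl fun z hz => hwt z (Finset.ne_of_mem_erase hz) _
  have e8 : K = (β + 1) / α * ∏ v ∈ (X.erase u).erase w, vertexWeight α β r X v := by
    rw [hK, ← Finset.mul_prod_erase (X.erase u) _ hwX, e6]
  have hmono' : ∏ v ∈ (X.erase u).erase w, vertexWeight α β r (X.erase w) v ≤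
      ∏ v ∈ (X.erase u).erase w, vertexWeight α β r X v :=
    Finset.prod_le_prod (fun v _ => (vertexWeight_pos ..).le) fun v _ => hmono v
  have bw' : pathWeight (rowsWeight β r) (X.erase w) w ≤ (β ^ 2 + 1) / (β * (β + 1)) *
      (lossRatio α β ^ (j + 1) * (1 + (j + 1))) * K := by
    rw [← mul_le_mul_iff_right₀ (by linarith : 0 < β)]
    refine b3.trans ?_
    rw [e7, e8]
    calc _ = (lossRatio α β ^ (j + 1) * (1 + (j + 1))) * capWeight α β β *
          ∏ v ∈ (X.erase u).erase w, vertexWeight α β r (X.erase w) v := by field_simp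
      _ ≤ (lossRatio α β ^ (j + 1) * (1 + (j + 1))) * capWeight α β β *
          ∏ v ∈ (X.erase u).erase w, vertexWeight α β r X v := by gcongr
      _ = _ := by
        rw [capWeight_beta hβ1 hα h]
        field_simp
  have key := mul_le_mul_of_nonneg_right (shared_target_bound' hβ hα h j)
    (zero_le_one.trans hK1)
  refine le_trans (add_le_add hbu bw') (le_trans (le_of_eq ?_) key)
  ring

end PathBoundMain

/-! ### Case analysis and the resulting bound for walks between two vertices. -/

section PathBoundTheorem

variable {V : Type*} [DecidableEq V] {α β : ℝ} {X : Finset V} {u w : V} {r : V → PathRow V}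

/-- For β ≥ 2 any in-neighbor yields the factor ρ = `lossRatio`, but (β + 1) ρ exceeds α. The cases
look for an additional loss: a heavy edge into u or w, an in-neighbor of u without a heavy edge, and
finally `step_of_light_neighbors`. -/
theorem step_of_two_le (hβ : 2 ≤ β) (hα : 0 < α) (h : α ^ 2 = β * α + 1)
    (ih : ∀ Y ⊂ X, PathBound α β Y) (hr : ∀ v, (r v).IsValid)
    (hu : u ∈ X) (hw : w ∈ X) (huw : u ≠ w)
    (hNu : (inNeighbors β r X u).Nonempty) (hNw : (inNeighbors β r X w).Nonempty) :
    β * pathWeight (rowsWeight β r) (X.erase u) u + pathWeight (rowsWeight β r) (X.erase w) w ≤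
      α * ∏ v ∈ X, vertexWeight α β r X v := by
  have hβ1 : 1 ≤ β := by linarith
  have hρ := lossRatio_pos (β := β) hα
  have hmax : max (lossRatio α β) (α / (β + 1)) = lossRatio α β :=
    max_eq_left (inv_capWeight_one_le hβ hα h)
  have hμ : 0 ≤ heavyLoss α β := le_max_of_le_left (by positivity)
  have hR : 0 ≤ ∏ v ∈ X, vertexWeight α β r X v :=
    zero_le_one.trans (one_le_prod_vertexWeight ..)
  have hPB : ∀ y ∈ X, PathBound α β (X.erase y) := fun y hy => ih _ (Finset.erase_ssubset hy)
  have hloss : ∀ y ∈ X, ∀ v ∈ inNeighbors β r X y,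
      vertexWeight α β r (X.erase y) v ≤ lossRatio α β * vertexWeight α β r X v := by
    intro y hy v hv
    obtain ⟨h1, h2⟩ := mem_inNeighbors.1 hv
    have := vertexWeight_erase_le hβ1 hα h (hr v) hy (Finset.ne_of_mem_erase h1) h2
    rwa [hmax] at this
  have hone : ∀ y ∈ X, (inNeighbors β r X y).Nonempty →
      pathWeight (rowsWeight β r) (X.erase y) y ≤
        lossRatio α β * ∏ v ∈ X, vertexWeight α β r X v := by
    rintro y hy ⟨v, hv⟩
    exact (hPB y hy).branch_le_one hβ1 hα h hr hy (inNeighbors_subset _ _ _ hv) hρ.le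
      (hloss y hy v hv)
  have hheavy : ∀ y ∈ X, ∀ v ∈ inNeighbors β r X y, ∀ b, r v = .edges (some y) b →
      pathWeight (rowsWeight β r) (X.erase y) y ≤
        heavyLoss α β * ∏ v ∈ X, vertexWeight α β r X v := by
    intro y hy v hv b hb
    have hv' := inNeighbors_subset _ _ _ hv
    exact (hPB y hy).branch_le_one hβ1 hα h hr hy hv' hμ
      (vertexWeight_erase_heavy hβ1 hα h (hr v) hy (Finset.ne_of_mem_erase hv') hb)
  by_cases h3a : ∃ v ∈ inNeighbors β r X u, ∃ b, r v = .edges (some u) b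
  · obtain ⟨v, hv, b, hb⟩ := h3a
    have h1 := mul_le_mul_of_nonneg_left (hheavy u hu v hv b hb) (by linarith : 0 ≤ β)
    have h2 := mul_le_mul_of_nonneg_right (beta_mul_heavyLoss hβ1 hα h) hR
    have h3 := hone w hw hNw
    linarith
  by_cases h3b : ∃ v ∈ inNeighbors β r X w, ∃ b, r v = .edges (some w) b
  · obtain ⟨v, hv, b, hb⟩ := h3b
    have h1 := mul_le_mul_of_nonneg_left (hone u hu hNu) (by linarith : 0 ≤ β)
    have h2 := mul_le_mul_of_nonneg_right (heavyLoss_add hβ1 hα h) hR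
    have h3 := hheavy w hw v hv b hb
    linarith
  have hlight : ∀ y, (¬ ∃ v ∈ inNeighbors β r X y, ∃ b, r v = .edges (some y) b) →
      ∀ v ∈ inNeighbors β r X y, ∃ a, a ≠ some y ∧ r v = .edges a (some y) := by
    intro y hy v hv
    obtain ⟨a, b, e, rfl | rfl⟩ := edges_of_mem_inNeighbors hv
    · exact absurd ⟨v, hv, b, e⟩ hy
    · exact ⟨a, fun ha => hy ⟨v, hv, some y, by rw [e, ha]⟩, e⟩
  by_cases hC : ∃ v ∈ inNeighbors β r X u, ∃ a, (¬ ∃ y ∈ X.erase v, a = some y) ∧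
      r v = .edges a (some u)
  · obtain ⟨v, hv, a, ha, hva⟩ := hC
    have hvX := inNeighbors_subset _ _ _ hv
    have hvu := Finset.ne_of_mem_erase hvX
    have hlv := vertexWeight_erase_light_only hβ1 hα h hu hvu ha hva
    by_cases hsole : inNeighbors β r X u = {v}
    · have h1 := pathWeight_le_of_sole_light_neighbor hβ1 hα h ih hr hu hw huw hsole ha hva
      have h2 := mul_le_mul_of_nonneg_left ((hPB u hu).branch_le_one hβ1 hα h hr hu hvX
        (by positivity) hlv.le) (by linarith : 0 ≤ β)
      -- Both branches carry the factor α/(β + 1), so the total is exactly α.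
      refine (add_le_add h2 h1).trans_eq ?_
      field_simp
    · obtain ⟨v', hv', hne⟩ : ∃ v' ∈ inNeighbors β r X u, v' ≠ v := by
        by_contra! H
        exact hsole (Finset.eq_singleton_iff_unique_mem.2 ⟨hv, H⟩)
      have h1 := (hPB u hu).branch_le' hβ1 hα h hr hu (N := {v', v})
        (c := fun z => if z = v then α / (β + 1) else lossRatio α β)
        (by
          intro z hz
          simp only [Finset.mem_insert, Finset.mem_singleton] at hz
          rcases hz with rfl | rfl
          · exact inNeighbors_subset _ _ _ hv'
          · exact hvX)
        (fun z _ => by split_ifs <;> positivity)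
        (by
          intro z hz
          simp only [Finset.mem_insert, Finset.mem_singleton] at hz
          by_cases hzv : z = v
          · subst hzv; simpa using hlv.le
          · simpa [hzv] using hloss u hu z (by rcases hz with rfl | rfl <;> assumption))
      rw [Finset.prod_pair hne, if_pos rfl, if_neg hne] at h1
      have h2 := mul_le_mul_of_nonneg_left h1 (by linarith : 0 ≤ β)
      have h3 := mul_le_mul_of_nonneg_right (lossRatio_single hβ1 hα h) hR
      have h4 := hone w hw hNw
      linarith
  refine step_of_light_neighbors hβ hα h ih hr hu hw huw hNu hNw ?_ (hlight w h3b)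
  intro v hv
  obtain ⟨a, ha, e⟩ := hlight u h3a v hv
  by_contra! H
  refine hC ⟨v, hv, a, ?_, e⟩
  rintro ⟨y, hy, rfl⟩
  exact H y hy (fun e' => ha (by rw [e'])) e

/-- For β = 1 any lost edge reduces the weight of its source to at most α/2 of it, and the two
branches of weight 1 add up to α. In contrast to β ≥ 2, here α/(β + 1) is the larger loss ratio. -/
theorem step_of_eq_one (hβ : β = 1) (hα : 0 < α) (h : α ^ 2 = β * α + 1)
    (ih : ∀ Y ⊂ X, PathBound α β Y) (hr : ∀ v, (r v).IsValid)
    (hu : u ∈ X) (hw : w ∈ X)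
    (hNu : (inNeighbors β r X u).Nonempty) (hNw : (inNeighbors β r X w).Nonempty) :
    β * pathWeight (rowsWeight β r) (X.erase u) u + pathWeight (rowsWeight β r) (X.erase w) w ≤
      α * ∏ v ∈ X, vertexWeight α β r X v := by
  have hβ1 : 1 ≤ β := hβ.ge
  have hmax : max (lossRatio α β) (α / (β + 1)) = α / 2 := by
    have h3 := root_cube h
    rw [max_eq_right]
    · rw [hβ]; norm_num
    · rw [lossRatio, div_le_div_iff₀ (by positivity) (by positivity)]
      subst hβ
      nlinarith
  have hone : ∀ y ∈ X, (inNeighbors β r X y).Nonempty →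
      pathWeight (rowsWeight β r) (X.erase y) y ≤
        α / 2 * ∏ v ∈ X, vertexWeight α β r X v := by
    rintro y hy ⟨v, hv⟩
    obtain ⟨h1, h2⟩ := mem_inNeighbors.1 hv
    have := vertexWeight_erase_le hβ1 hα h (hr v) hy (Finset.ne_of_mem_erase h1) h2
    rw [hmax] at this
    exact (ih _ (Finset.erase_ssubset hy)).branch_le_one hβ1 hα h hr hy h1 (by positivity) this
  have h1 := hone u hu hNu
  have h2 := hone w hw hNw
  rw [hβ] at *
  linarith

/-- The total weight of the self-avoiding walks from `s`, where each vertex has a heavy edge of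
weight `β` and a light edge of weight `1` with different targets. -/
theorem pathBound (hβ : β = 1 ∨ 2 ≤ β) (hα : 0 < α) (h : α ^ 2 = β * α + 1) (X : Finset V) :
    PathBound α β X := by
  have hβ1 : 1 ≤ β := by rcases hβ with h | h <;> linarith
  induction X using Finset.strongInduction with
  | H X ih =>
    intro r hr s hs
    have hR := one_le_prod_vertexWeight α β r X X
    have hbranch : ∀ y ∈ X, pathWeight (rowsWeight β r) (X.erase y) y ≤
        ∏ v ∈ X, vertexWeight α β r X v := by
      intro y hy
      have := (ih _ (Finset.erase_ssubset hy)).branch_le' hβ1 hα h hr hy (N := ∅)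
        (c := 0) (Finset.empty_subset _) (by simp) (by simp)
      simpa using this
    rcases hrs : r s with _ | ⟨a, b⟩
    · rw [pathWeight_eq, rowsWeight, hrs]
      simpa [PathRow.weight, PathRow.capacity] using hR
    rw [pathWeight_of_edges hrs]
    by_cases ha : ∃ y ∈ X, a = some y
    · obtain ⟨u, hu, rfl⟩ := ha
      rw [Finset.sum_ite_some_eq hu fun y => β * pathWeight (rowsWeight β r) (X.erase y) y]
      rw [PathRow.capacity, if_pos ⟨u, hu, rfl⟩]
      by_cases hb : ∃ y ∈ X, b = some y
      · rw [if_pos hb]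
        obtain ⟨w, hw, rfl⟩ := hb
        rw [Finset.sum_ite_some_eq hw]
        have huw : u ≠ w := by
          have := hr s
          rw [hrs] at this
          exact fun e => this u rfl (by rw [e])
        rcases (inNeighbors β r X u).eq_empty_or_nonempty with hNu | hNu
        · exact step_of_heavy_isolated hβ1 hα h ih hr hu hw huw hNu
        rcases (inNeighbors β r X w).eq_empty_or_nonempty with hNw | hNw
        · exact step_of_light_isolated hβ1 hα h ih hr hu hw huw hNw
        rcases hβ with hβ | hβ
        · exact step_of_eq_one hβ hα h ih hr hu hw hNu hNw
        · exact step_of_two_le hβ hα h ih hr hu hw huw hNu hNw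
      · rw [if_neg hb, Finset.sum_ite_some_eq_zero hb, add_zero]
        have := hbranch u hu
        gcongr
    · rw [Finset.sum_ite_some_eq_zero ha fun y => β * pathWeight (rowsWeight β r) (X.erase y) y,
        PathRow.capacity, if_neg ha, zero_add]
      by_cases hb : ∃ y ∈ X, b = some y
      · rw [if_pos hb, one_mul]
        obtain ⟨w, hw, rfl⟩ := hb
        rw [Finset.sum_ite_some_eq hw]
        exact hbranch w hw
      · rw [if_neg hb, Finset.sum_ite_some_eq_zero hb, zero_mul]

/-- The total weight of the self-avoiding walks from `s` to `t`. -/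
theorem pathWeight_le [Fintype V] (hβ : β = 1 ∨ 2 ≤ β) (hα : 0 < α) (h : α ^ 2 = β * α + 1)
    (r : V → PathRow V) (hr : ∀ v, (r v).IsValid) (s t : V) (ht : r t = .halt) :
    pathWeight (rowsWeight β r) (Finset.univ.erase s) s ≤
      2 * α ^ (Fintype.card V - 1) := by
  have hβ1 : 1 ≤ β := by rcases hβ with h | h <;> linarith
  have hβα := root_bounds hβ1 hα h
  have hα1 : 1 ≤ α := hβ1.trans hβα.1.le
  refine (pathBound hβ hα h _ r hr s (Finset.notMem_erase _ _)).trans ?_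
  by_cases hst : t = s
  · subst hst
    rw [ht, PathRow.capacity, one_mul]
    have : ∏ v ∈ Finset.univ.erase t, vertexWeight α β r (Finset.univ.erase t) v ≤
        ∏ _v ∈ Finset.univ.erase t, α :=
      Finset.prod_le_prod (fun v _ => (vertexWeight_pos ..).le) fun v _ =>
        capWeight_le hβ1 hα h ((r v).capacity_le hβ1 hβα.1.le _)
    rw [Finset.prod_const, Finset.card_erase_of_mem (Finset.mem_univ _), Finset.card_univ] at this
    have : 0 ≤ α ^ (Fintype.card V - 1) := by positivity
    linarith
  · have htX : t ∈ Finset.univ.erase s := Finset.mem_erase.2 ⟨hst, Finset.mem_univ _⟩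
    rw [← Finset.mul_prod_erase _ _ htX]
    have h1 : vertexWeight α β r (Finset.univ.erase s) t = (β + 1) / α := by
      rw [vertexWeight, ht, PathRow.capacity, capWeight_one hβ1 hα h]
    have h2 : ∏ v ∈ (Finset.univ.erase s).erase t, vertexWeight α β r (Finset.univ.erase s) v ≤
        ∏ _v ∈ (Finset.univ.erase s).erase t, α :=
      Finset.prod_le_prod (fun v _ => (vertexWeight_pos ..).le) fun v _ =>
        capWeight_le hβ1 hα h ((r v).capacity_le hβ1 hβα.1.le _)
    rw [Finset.prod_const, Finset.card_erase_of_mem htX,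
      Finset.card_erase_of_mem (Finset.mem_univ _), Finset.card_univ] at h2
    have h3 := (r s).capacity_le hβ1 hβα.1.le (Finset.univ.erase s)
    have hcard : Fintype.card V - 1 = (Fintype.card V - 1 - 1) + 1 := by
      have := Finset.card_pos.2 ⟨t, htX⟩
      rw [Finset.card_erase_of_mem (Finset.mem_univ _), Finset.card_univ] at this
      omega
    rw [h1]
    have h4 : 0 ≤ ∏ v ∈ (Finset.univ.erase s).erase t,
        vertexWeight α β r (Finset.univ.erase s) v :=
      zero_le_one.trans (one_le_prod_vertexWeight ..)
    -- The start has capacity at most α, the end t has weight (β + 1)/α, and each other vertex at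
    -- most α. The constant 2 comes from β + 1 ≤ 2α.
    calc _ ≤ α * ((β + 1) / α * α ^ (Fintype.card V - 1 - 1)) := by gcongr
      _ = (β + 1) * α ^ (Fintype.card V - 1 - 1) := by field_simp
      _ ≤ (2 * α) * α ^ (Fintype.card V - 1 - 1) := by gcongr; linarith
      _ = 2 * α ^ (Fintype.card V - 1 - 1 + 1) := by ring
      _ = _ := by rw [← hcard]

end PathBoundTheorem

/-! ### From actions to heavy and light edges, and from policies to lassos. -/

section Lassos

variable {S A : Type*}

/-- The row `f` of edge weights can be replaced by a row with a heavy edge and a light edge, without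
making a given linear functional smaller. -/
def IsDominated [DecidableEq S] (β : ℝ) (f : Option S → ℝ) : Prop :=
  ∀ (X : Finset S) (b : ℝ) (c : S → ℝ), (∀ y, 0 ≤ c y) → ∃ R : PathRow S, R.IsValid ∧
    f none * b + ∑ y ∈ X, f (some y) * c y ≤
      R.weight β none * b + ∑ y ∈ X, R.weight β (some y) * c y

/-- Rows are replaced one at a time. With the others fixed, the weight is affine in the row, with
nonnegative coefficients on the edges, which is the kind of functional that `IsDominated` quantifies
over. -/
theorem exists_rows_pathWeight_le [DecidableEq S] {β : ℝ} (hβ : 1 ≤ β) {W : S → Option S → ℝ}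
    (hW : ∀ v o, 0 ≤ W v o) {X : Finset S} {s : S} (hs : s ∉ X) (F : Finset S)
    (hF : ∀ v ∈ F, IsDominated β (W v)) :
    ∃ r : S → PathRow S, (∀ v, (r v).IsValid) ∧
      pathWeight W X s ≤ pathWeight (fun v => if v ∈ F then (r v).weight β else W v) X s := by
  induction F using Finset.induction_on with
  | empty => exact ⟨fun _ => .halt, fun _ => trivial, by simp⟩
  | insert v F hv ih =>
    obtain ⟨r, hr, hle⟩ := ih fun y hy => hF y (Finset.mem_insert_of_mem hy)
    set W' : S → Option S → ℝ := fun v => if v ∈ F then (r v).weight β else W v with hW'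
    have hW'0 : ∀ v o, 0 ≤ W' v o := by
      intro y o
      simp only [hW']
      split_ifs
      · exact (r y).weight_nonneg hβ o
      · exact hW y o
    obtain ⟨a, b, c, hc, hlin⟩ := pathWeight_update_eq hW'0 X hs v
    obtain ⟨R, hR, hRle⟩ := hF v (Finset.mem_insert_self _ _) X b c hc
    refine ⟨Function.update r v R, ?_, hle.trans ?_⟩
    · intro y
      by_cases hy : y = v
      · subst hy; simpa using hR
      · simpa [hy] using hr y
    · have e1 : W' = Function.update W' v (W v) := by
        rw [eq_comm, Function.update_eq_self_iff]
        simp [hW', hv]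
      have e2 : (fun y => if y ∈ insert v F then (Function.update r v R y).weight β else W y) =
          Function.update W' v (R.weight β) := by
        funext y
        by_cases hy : y = v
        · subst hy; simp
        · simp [hy, hW']
      rw [e2, e1, Function.update_idem, hlin, hlin]
      linarith

variable [DecidableEq S] (next : S → A → S) (Act : S → Finset A)

/-- The number of the available actions which lead from `v` to a given state. -/
noncomputable def actionRow (v : S) : Option S → ℝ
  | none => 0
  | some y => ((Act v).filter fun a => next v a = y).card

/-- The edge weights for the walks which end at `t`. -/
noncomputable def actionWeights (t : S) : S → Option S → ℝ :=
  Function.update (actionRow next Act) t (PathRow.halt.weight 1)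

theorem actionRow_nonneg (v : S) (o : Option S) : 0 ≤ actionRow next Act v o := by
  rcases o with _ | y
  · exact le_rfl
  · exact Nat.cast_nonneg _

theorem actionWeights_nonneg (t v : S) (o : Option S) : 0 ≤ actionWeights next Act t v o := by
  by_cases h : v = t
  · subst h
    simpa [actionWeights] using PathRow.halt.weight_nonneg le_rfl o
  · simpa [actionWeights, h] using actionRow_nonneg next Act v o

theorem sum_actionRow_mul (v : S) (X : Finset S) (c : S → ℝ) :
    ∑ y ∈ X, actionRow next Act v (some y) * c y =
      ∑ a ∈ Act v, if next v a ∈ X then c (next v a) else 0 := by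
  have : ∀ y ∈ X, actionRow next Act v (some y) * c y =
      ∑ a ∈ Act v, if next v a = y then c y else 0 := by
    intro y _
    rw [actionRow, ← Finset.sum_filter, Finset.sum_const, nsmul_eq_mul]
  rw [Finset.sum_congr rfl this, Finset.sum_comm]
  refine Finset.sum_congr rfl fun a _ => ?_
  rw [Finset.sum_ite_eq]

theorem isDominated_actionRow_of_singleton {β : ℝ} {v : S} {a : A} (h : Act v = {a}) :
    IsDominated β (actionRow next Act v) := by
  intro X b c hc
  refine ⟨.edges none (some (next v a)), fun y h => by simp at h, ?_⟩
  rw [sum_actionRow_mul, h, Finset.sum_singleton]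
  simp [actionRow, PathRow.weight]

variable [DecidableEq A]

/-- Keep one action whose target differs from the best target, and redirect all the others, k - 1 =
β in number, to the best one. -/
theorem isDominated_actionRow_of_ne {β : ℝ} {v : S} (hcard : ((Act v).card : ℝ) = β + 1)
    (hne : ∃ a ∈ Act v, ∃ a' ∈ Act v, next v a ≠ next v a') :
    IsDominated β (actionRow next Act v) := by
  intro X b c hc
  set d : S → ℝ := fun y => if y ∈ X then c y else 0 with hd
  obtain ⟨a₀, ha₀, a₁, ha₁, hne⟩ := hne
  obtain ⟨u, hu, hmax⟩ := Finset.exists_max_image (Act v) (fun a => d (next v a)) ⟨a₀, ha₀⟩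
  obtain ⟨w, hw, hwu⟩ : ∃ w ∈ Act v, next v u ≠ next v w := by
    by_cases h : next v u = next v a₀
    · exact ⟨a₁, ha₁, h ▸ hne⟩
    · exact ⟨a₀, ha₀, h⟩
  refine ⟨.edges (some (next v u)) (some (next v w)), ?_, ?_⟩
  · intro y h h'
    exact hwu ((Option.some.inj h).trans (Option.some.inj h').symm)
  · have e1 : ∑ y ∈ X, (PathRow.edges (some (next v u)) (some (next v w))).weight β (some y) * c y =
        β * d (next v u) + d (next v w) := by
      simp only [PathRow.weight, add_mul, ite_mul, zero_mul, one_mul, Option.some.injEq,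
        Finset.sum_add_distrib, Finset.sum_ite_eq, hd]
      simp
    rw [sum_actionRow_mul, e1]
    simp only [actionRow, PathRow.weight, zero_mul, zero_add]
    rw [← Finset.add_sum_erase _ _ hw, add_comm]
    gcongr
    · refine (Finset.sum_le_card_nsmul _ _ (d (next v u))
        fun a ha => hmax a (Finset.mem_of_mem_erase ha)).trans_eq ?_
      rw [nsmul_eq_mul, Finset.card_erase_of_mem hw,
        Nat.cast_sub (Finset.card_pos.2 ⟨w, hw⟩), hcard]
      simp

variable [Fintype S]

/-- The total weight of the self-avoiding walks from `s` to `t`, where at each vertex there is a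
single action, or the actions do not all have the same target. -/
theorem pathWeight_actionWeights_le {α β : ℝ} (hβ : β = 1 ∨ 2 ≤ β) (hα : 0 < α)
    (h : α ^ 2 = β * α + 1)
    (hAct : ∀ v, (∃ a, Act v = {a}) ∨
      (((Act v).card : ℝ) = β + 1 ∧ ∃ a ∈ Act v, ∃ a' ∈ Act v, next v a ≠ next v a'))
    (s t : S) :
    pathWeight (actionWeights next Act t) (Finset.univ.erase s) s ≤
      2 * α ^ (Fintype.card S - 1) := by
  have hβ1 : 1 ≤ β := by rcases hβ with h | h <;> linarith
  obtain ⟨r, hr, hle⟩ := exists_rows_pathWeight_le hβ1 (actionWeights_nonneg next Act t)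
    (Finset.notMem_erase s Finset.univ) (Finset.univ.erase t) (by
      intro v hv
      rw [actionWeights, Function.update_of_ne (Finset.ne_of_mem_erase hv)]
      rcases hAct v with ⟨a, ha⟩ | ⟨h1, h2⟩
      · exact isDominated_actionRow_of_singleton next Act ha
      · exact isDominated_actionRow_of_ne next Act h1 h2)
  have e : (fun v => if v ∈ Finset.univ.erase t then (r v).weight β
      else actionWeights next Act t v) = rowsWeight β (Function.update r t .halt) := by
    rw [rowsWeight_update]
    funext v
    by_cases hv : v = t
    · subst hv
      funext o
      rcases o with _ | o <;> simp [actionWeights, PathRow.weight]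
    · simp [hv, rowsWeight]
  rw [e] at hle
  refine hle.trans (pathWeight_le hβ hα h _ ?_ s t (by simp))
  intro v
  by_cases hv : v = t
  · subst hv; simp [PathRow.IsValid]
  · simpa [hv] using hr v

/-- A function of a policy which depends only on the part of the policy that is used when starting
at `s₀` takes at most as many values as there are walks from `s₀` to the end of a lasso. -/
theorem card_image_le_sum_pathWeight {k : ℕ} (hk : ∀ v, (Act v).card ≤ k) {s₀ : S}
    (val : (S → A) → ℝ)
    (hval : ∀ π π' : S → A, ∀ K : Finset S, s₀ ∈ K → (∀ v ∈ K, next v (π v) ∈ K) →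
      (∀ v ∈ K, π v = π' v) → val π = val π')
    (X : Finset S) {s : S} (hs : s ∉ X) (hs₀ : s₀ ∉ X) (P : Finset (S → A))
    (hP : ∀ π ∈ P, ∀ v, π v ∈ Act v)
    (hagree : ∀ π ∈ P, ∀ π' ∈ P, ∀ v ∉ insert s X, π v = π' v)
    (hclosed : ∀ π ∈ P, ∀ v ∉ insert s X, next v (π v) ∉ X) :
    ((P.image val).card : ℝ) ≤
      k * ∑ t ∈ insert s X, pathWeight (actionWeights next Act t) X s := by
  induction X using Finset.strongInduction generalizing s P with
  | H X ih =>
    -- The states outside X have been visited, s being the current one; the policies in P can differ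
    -- only at s and inside X. Branch on the action at s.
    have hcover : P.image val ⊆
        (Act s).biUnion fun a => (P.filter fun π => π s = a).image val := by
      intro x hx
      obtain ⟨π, hπ, rfl⟩ := Finset.mem_image.1 hx
      exact Finset.mem_biUnion.2 ⟨π s, hP π hπ s, Finset.mem_image_of_mem _
        (Finset.mem_filter.2 ⟨hπ, rfl⟩)⟩
    have hstep : ∀ a ∈ Act s, (((P.filter fun π => π s = a).image val).card : ℝ) ≤
        (if next s a ∈ X then k * ∑ t ∈ X, pathWeight (actionWeights next Act t)
          (X.erase (next s a)) (next s a) else 0) + 1 := by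
      intro a _
      by_cases ha : next s a ∈ X
      · rw [if_pos ha]
        have := ih _ (Finset.erase_ssubset ha) (Finset.notMem_erase _ _)
          (fun h => hs₀ (Finset.mem_of_mem_erase h)) (P.filter fun π => π s = a)
          (fun π hπ => hP π (Finset.mem_filter.1 hπ).1)
          (by
            intro π hπ π' hπ' v hv
            rw [Finset.insert_erase ha] at hv
            obtain ⟨h1, h2⟩ := Finset.mem_filter.1 hπ
            obtain ⟨h3, h4⟩ := Finset.mem_filter.1 hπ'
            by_cases hvs : v = s
            · rw [hvs, h2, h4]
            · exact hagree π h1 π' h3 v (by simp [hvs, hv]))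
          (by
            intro π hπ v hv
            rw [Finset.insert_erase ha] at hv
            obtain ⟨h1, h2⟩ := Finset.mem_filter.1 hπ
            by_cases hvs : v = s
            · rw [hvs, h2]
              exact Finset.notMem_erase _ _
            · exact fun h => hclosed π h1 v (by simp [hvs, hv]) (Finset.mem_of_mem_erase h))
        rw [Finset.insert_erase ha] at this
        linarith
      -- The action returns to a visited state and closes the lasso: the visited states are closed
      -- under the policy, so a single value is possible.
      · rw [if_neg ha, zero_add]
        refine Nat.cast_le_one.2 (Finset.card_le_one.2 ?_)
        intro x hx y hy
        obtain ⟨π, hπ, rfl⟩ := Finset.mem_image.1 hx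
        obtain ⟨π', hπ', rfl⟩ := Finset.mem_image.1 hy
        obtain ⟨h1, h2⟩ := Finset.mem_filter.1 hπ
        obtain ⟨h3, h4⟩ := Finset.mem_filter.1 hπ'
        refine hval π π' Xᶜ (by simpa using hs₀) ?_ ?_
        · intro v hv
          rw [Finset.mem_compl] at hv ⊢
          by_cases hvs : v = s
          · rw [hvs, h2]; exact ha
          · exact hclosed π h1 v (by simp [hvs, hv])
        · intro v hv
          rw [Finset.mem_compl] at hv
          by_cases hvs : v = s
          · rw [hvs, h2, h4]
          · exact hagree π h1 π' h3 v (by simp [hvs, hv])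
    -- The walk of length zero accounts for the at most k actions that close the lasso at s.
    have hs_row : pathWeight (actionWeights next Act s) X s = 1 := by
      rw [pathWeight_eq]
      simp [actionWeights, PathRow.weight]
    have ht_row : ∀ t ∈ X, pathWeight (actionWeights next Act t) X s =
        ∑ a ∈ Act s, if next s a ∈ X then pathWeight (actionWeights next Act t)
          (X.erase (next s a)) (next s a) else 0 := by
      intro t ht
      have hst : s ≠ t := fun e => hs (e ▸ ht)
      rw [pathWeight_eq]
      have : actionWeights next Act t s = actionRow next Act s := by
        rw [actionWeights, Function.update_of_ne hst]
      rw [this, sum_actionRow_mul next Act s X fun y =>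
        pathWeight (actionWeights next Act t) (X.erase y) y]
      simp [actionRow]
    have h1 : ((P.image val).card : ℝ) ≤
        ∑ a ∈ Act s, (((P.filter fun π => π s = a).image val).card : ℝ) := by
      exact_mod_cast (Finset.card_le_card hcover).trans Finset.card_biUnion_le
    refine h1.trans ((Finset.sum_le_sum hstep).trans ?_)
    rw [Finset.sum_insert hs, hs_row, Finset.sum_congr rfl ht_row, Finset.sum_add_distrib,
      Finset.sum_comm, mul_add, mul_one, Finset.mul_sum, add_comm]
    refine add_le_add ?_ (le_of_eq ?_)
    · simpa using hk s
    · refine Finset.sum_congr rfl fun a _ => ?_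
      split_ifs <;> simp

theorem card_image_le {α β : ℝ} (hβ : β = 1 ∨ 2 ≤ β) (hα : 0 < α)
    (h : α ^ 2 = β * α + 1) {k : ℕ} (hk : ∀ v, (Act v).card ≤ k)
    (hAct : ∀ v, (∃ a, Act v = {a}) ∨
      (((Act v).card : ℝ) = β + 1 ∧ ∃ a ∈ Act v, ∃ a' ∈ Act v, next v a ≠ next v a'))
    {s₀ : S} (val : (S → A) → ℝ)
    (hval : ∀ π π' : S → A, ∀ K : Finset S, s₀ ∈ K → (∀ v ∈ K, next v (π v) ∈ K) →
      (∀ v ∈ K, π v = π' v) → val π = val π')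
    (P : Finset (S → A)) (hP : ∀ π ∈ P, ∀ v, π v ∈ Act v) :
    ((P.image val).card : ℝ) ≤ k * (Fintype.card S * (2 * α ^ (Fintype.card S - 1))) := by
  have hu : insert s₀ (Finset.univ.erase s₀) = Finset.univ :=
    Finset.insert_erase (Finset.mem_univ s₀)
  refine (card_image_le_sum_pathWeight next Act hk val hval (Finset.univ.erase s₀)
    (Finset.notMem_erase _ _) (Finset.notMem_erase _ _) P hP (by simp) (by simp)).trans ?_
  gcongr
  rw [hu]
  refine (Finset.sum_le_card_nsmul _ _ _ fun t _ =>
    pathWeight_actionWeights_le next Act hβ hα h hAct s₀ t).trans_eq ?_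
  rw [nsmul_eq_mul, Finset.card_univ]

end Lassos

/-! ### Bellman equation, policy improvement, and chains of vectors. -/

section ValueFunctions

namespace MDP

variable {S A : Type*} [Fintype S]

theorem stateProb_succ' (M : MDP S A) (π : S → A) (s : S) (t : ℕ) (s' : S) :
    M.stateProb π s (t + 1) s' = ∑ u, M.T s (π s) u * M.stateProb π u t s' := by
  induction t generalizing s' with
  | zero => classical simp [stateProb, eq_comm]
  | succ t ih =>
    rw [stateProb]
    simp_rw [ih, stateProb, Finset.sum_mul, Finset.mul_sum]
    rw [Finset.sum_comm]
    simp_rw [mul_assoc]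

theorem expectedReward_zero (M : MDP S A) (π : S → A) (s : S) :
    M.expectedReward π s 0 = M.R s (π s) := by
  classical simp [expectedReward, stateProb]

theorem expectedReward_succ (M : MDP S A) (π : S → A) (s : S) (t : ℕ) :
    M.expectedReward π s (t + 1) = ∑ u, M.T s (π s) u * M.expectedReward π u t := by
  simp_rw [expectedReward, stateProb_succ', Finset.sum_mul, Finset.mul_sum]
  rw [Finset.sum_comm]
  simp_rw [mul_assoc]

/-- The Bellman equation. -/
theorem value_eq (M : MDP S A) (π : S → A) (s : S) :
    M.value π s = M.actionValue π s (π s) := by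
  rw [value, (M.summable_value π s).tsum_eq_zero_add, expectedReward_zero, pow_zero, one_mul,
    actionValue]
  congr 1
  have h : ∀ t : ℕ, M.γ ^ (t + 1) * M.expectedReward π s (t + 1) =
      ∑ u, M.γ * M.T s (π s) u * (M.γ ^ t * M.expectedReward π u t) := by
    intro t
    rw [expectedReward_succ, Finset.mul_sum]
    exact Finset.sum_congr rfl fun u _ => by ring
  simp_rw [h]
  rw [Summable.tsum_finsetSum fun u _ => (M.summable_value π u).mul_left _, Finset.mul_sum]
  refine Finset.sum_congr rfl fun u _ => ?_
  rw [tsum_mul_left, value, mul_assoc]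

theorem gain_self (M : MDP S A) (π : S → A) (s : S) : M.gain π s (π s) = 0 := by
  rw [gain, ← value_eq, sub_self]

/-- A function which is at least its discounted average is nonnegative. -/
theorem nonneg_of_discounted_le (M : MDP S A) (π : S → A) {D : S → ℝ}
    (hD : ∀ s, M.γ * ∑ u, M.T s (π s) u * D u ≤ D s) (s : S) : 0 ≤ D s := by
  have : Nonempty S := ⟨s⟩
  -- At a minimum m the average is at least D m, so D m ≥ γ D m with γ < 1.
  obtain ⟨m, hm⟩ := Finite.exists_min D
  have h1 : D m ≤ ∑ u, M.T m (π m) u * D u := by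
    calc D m = ∑ u, M.T m (π m) u * D m := by rw [← Finset.sum_mul, M.T_sum, one_mul]
      _ ≤ _ := Finset.sum_le_sum fun u _ => mul_le_mul_of_nonneg_left (hm u) (M.T_nonneg _ _ _)
  have h2 := mul_le_mul_of_nonneg_left h1 M.γ_nonneg
  have h3 := hD m
  have h4 := M.γ_lt_one
  have : 0 ≤ D m := by nlinarith
  exact this.trans (hm s)

/-- The difference of the values solves the Bellman equation of π' with the gains of π as rewards.
Hence the signs of these gains decide the comparison, both for optimality and for improvement. -/
theorem value_sub_value (M : MDP S A) (π π' : S → A) (s : S) :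
    M.value π' s - M.value π s = M.gain π s (π' s) +
      M.γ * ∑ u, M.T s (π' s) u * (M.value π' u - M.value π u) := by
  rw [value_eq M π' s, actionValue, gain, actionValue]
  simp_rw [mul_sub, Finset.sum_sub_distrib]
  ring

/-- A policy without improving actions is optimal. -/
theorem isOptimal_of_improvableSet_eq_empty (M : MDP S A) {π : S → A}
    (h : M.improvableSet π = ∅) : M.IsOptimal π := by
  intro π' s
  have hg : ∀ s a, M.gain π s a ≤ 0 := by
    intro s a
    by_contra! H
    have : (s, a) ∈ M.improvableSet π := H
    simp [h] at this
  have := M.nonneg_of_discounted_le π' (D := fun s => M.value π s - M.value π' s) (by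
    intro s
    have h1 := M.value_sub_value π π' s
    have h2 := hg s (π' s)
    have h3 : ∑ u, M.T s (π' s) u * (M.value π' u - M.value π u) =
        -∑ u, M.T s (π' s) u * (M.value π u - M.value π' u) := by
      rw [← Finset.sum_neg_distrib]
      exact Finset.sum_congr rfl fun u _ => by ring
    rw [h3] at h1
    linarith) s
  linarith

theorem IsLocallyImproving.gain_pos {M : MDP S A} {π π' : S → A}
    (h : M.IsLocallyImproving π π') :
    (∀ s, π' s = π s ∨ 0 < M.gain π s (π' s)) ∧ ∃ s, 0 < M.gain π s (π' s) := by
  obtain ⟨I, ⟨hI, ⟨p, hp⟩, -⟩, h1, h2⟩ := h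
  refine ⟨fun s => ?_, p.1, ?_⟩
  · by_cases hs : ∃ a, (s, a) ∈ I
    · obtain ⟨a, ha⟩ := hs
      rw [h1 s a ha]
      exact Or.inr (hI ha)
    · exact Or.inl (h2 s fun a ha => hs ⟨a, ha⟩)
  · rw [h1 p.1 p.2 hp]
    exact hI hp

/-- Policy improvement: the values do not decrease, and some value increases. -/
theorem IsLocallyImproving.value_le {M : MDP S A} {π π' : S → A}
    (h : M.IsLocallyImproving π π') :
    (∀ s, M.value π s ≤ M.value π' s) ∧ ∃ s, M.value π s < M.value π' s := by
  obtain ⟨h1, s₀, h2⟩ := h.gain_pos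
  have hg : ∀ s, 0 ≤ M.gain π s (π' s) := by
    intro s
    rcases h1 s with e | e
    · rw [e, gain_self]
    · exact e.le
  have hD := M.nonneg_of_discounted_le π' (D := fun s => M.value π' s - M.value π s) (by
    intro s
    have := M.value_sub_value π π' s
    have := hg s
    linarith)
  refine ⟨fun s => sub_nonneg.1 (hD s), s₀, sub_pos.1 ?_⟩
  rw [value_sub_value]
  exact add_pos_of_pos_of_nonneg h2 (mul_nonneg M.γ_nonneg
    (Finset.sum_nonneg fun u _ => mul_nonneg (M.T_nonneg _ _ _) (hD u)))

theorem IsHowardRun.isRun {M : MDP S A} {π : ℕ → S → A} (h : M.IsHowardRun π) : M.IsRun π := by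
  intro t ht
  obtain ⟨I, h1, -, h2⟩ := h t ht
  exact ⟨I, h1, h2⟩

open Classical in
/-- In a deterministic MDP every state-action pair has a unique next state. -/
theorem IsDeterministic.exists_next {M : MDP S A} (h : M.IsDeterministic) :
    ∃ next : S → A → S, ∀ s a s', M.T s a s' = if s' = next s a then 1 else 0 := by
  have : ∀ s a, ∃ u, ∀ s', M.T s a s' = if s' = u then 1 else 0 := by
    intro s a
    have hsum := M.T_sum s a
    obtain ⟨u, hu⟩ : ∃ u, M.T s a u = 1 := by
      by_contra! H
      have : ∀ s', M.T s a s' = 0 := fun s' => (h s a s').resolve_right (H s')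
      simp [this] at hsum
    refine ⟨u, fun s' => ?_⟩
    split_ifs with e
    · rw [e, hu]
    · rw [← Finset.add_sum_erase _ _ (Finset.mem_univ u), hu] at hsum
      have h0 : ∑ x ∈ Finset.univ.erase u, M.T s a x = 0 := by linarith
      exact (Finset.sum_eq_zero_iff_of_nonneg fun x _ => M.T_nonneg s a x).1 h0 s'
        (Finset.mem_erase.2 ⟨e, Finset.mem_univ _⟩)
  choose next hnext using this
  exact ⟨next, hnext⟩

section Deterministic

variable {M : MDP S A} {next : S → A → S}

open Classical in
theorem actionValue_of_next
    (hnext : ∀ s a s', M.T s a s' = if s' = next s a then 1 else 0) (π : S → A) (s : S) (a : A) :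
    M.actionValue π s a = M.R s a + M.γ * M.value π (next s a) := by
  simp [actionValue, hnext]

open Classical in
/-- The values depend only on the actions in the states which are reached. -/
theorem value_congr (hnext : ∀ s a s', M.T s a s' = if s' = next s a then 1 else 0)
    {π π' : S → A} (K : Finset S) (hK : ∀ v ∈ K, next v (π v) ∈ K)
    (h : ∀ v ∈ K, π v = π' v) {s : S} (hs : s ∈ K) : M.value π s = M.value π' s := by
  -- Where the difference is largest on K, the Bellman equations bound it by γ times itself.
  obtain ⟨m, hm, hmax⟩ := Finset.exists_max_image K (fun v => |M.value π v - M.value π' v|) ⟨s, hs⟩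
  have e : M.value π m - M.value π' m =
      M.γ * (M.value π (next m (π m)) - M.value π' (next m (π m))) := by
    rw [value_eq M π m, value_eq M π' m, actionValue_of_next hnext, actionValue_of_next hnext,
      ← h m hm]
    ring
  have h1 := hmax _ (hK m hm)
  have h2 : |M.value π m - M.value π' m| =
      M.γ * |M.value π (next m (π m)) - M.value π' (next m (π m))| := by
    rw [e, abs_mul, abs_of_nonneg M.γ_nonneg]
  have h3 := M.γ_lt_one
  have h4 := mul_le_mul_of_nonneg_left h1 M.γ_nonneg
  have h5 := abs_nonneg (M.value π m - M.value π' m)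
  have h6 : |M.value π m - M.value π' m| ≤ 0 := by nlinarith
  exact sub_eq_zero.1 (abs_nonpos_iff.1 ((hmax s hs).trans h6))

open Classical in
/-- In a state where two actions have the same target, policy improvement switches between them
only if the reward increases. -/
theorem reward_lt_of_gain_pos (hnext : ∀ s a s', M.T s a s' = if s' = next s a then 1 else 0)
    {π : S → A} {s : S} {a : A} (h : 0 < M.gain π s a) (hs : next s (π s) = next s a) :
    M.R s (π s) < M.R s a := by
  have h0 := M.gain_self π s
  rw [gain, actionValue_of_next hnext] at h h0
  rw [hs] at h0
  linarith

end Deterministic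

end MDP

/-- A monotone sequence of vectors takes few values if its coordinates take few values. -/
theorem Finset.card_image_add_card_le {ι : Type*} [Fintype ι] {T : Finset ℕ} (hT : T.Nonempty)
    (f : ℕ → ι → ℝ) (hf : ∀ t ∈ T, ∀ t' ∈ T, t ≤ t' → f t ≤ f t') :
    (T.image f).card + Fintype.card ι ≤ ∑ i, (T.image fun t => f t i).card + 1 := by
  classical
  -- The rank of a vector: the number of attained values below each coordinate, summed up. It
  -- increases strictly along the chain, and no value lies below itself, so coordinate i contributes
  -- at most its number of values minus one.
  set g : (ι → ℝ) → ℕ := fun x => ∑ i, ((T.image fun t => f t i).filter fun y => y < x i).card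
    with hg
  have hlt : ∀ x ∈ T.image f, ∀ y ∈ T.image f, x ≤ y → x ≠ y → g x < g y := by
    intro x hx y hy hxy hne
    obtain ⟨i, hi⟩ : ∃ i, x i < y i := by
      by_contra! H
      exact hne (le_antisymm hxy H)
    obtain ⟨t, ht, rfl⟩ := Finset.mem_image.1 hx
    refine Finset.sum_lt_sum (fun j _ => Finset.card_le_card fun z hz => ?_)
      ⟨i, Finset.mem_univ _, Finset.card_lt_card (Finset.ssubset_iff_of_subset (fun z hz => ?_) |>.2
        ⟨f t i, Finset.mem_filter.2 ⟨Finset.mem_image_of_mem _ ht, hi⟩, by simp⟩)⟩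
    · obtain ⟨h1, h2⟩ := Finset.mem_filter.1 hz
      exact Finset.mem_filter.2 ⟨h1, h2.trans_le (hxy j)⟩
    · obtain ⟨h1, h2⟩ := Finset.mem_filter.1 hz
      exact Finset.mem_filter.2 ⟨h1, h2.trans_le (hxy i)⟩
  have hinj : Set.InjOn g (T.image f) := by
    intro x hx y hy hxy
    by_contra hne
    obtain ⟨t, ht, rfl⟩ := Finset.mem_image.1 hx
    obtain ⟨t', ht', rfl⟩ := Finset.mem_image.1 hy
    rcases le_total t t' with h | h
    · exact (hlt _ hx _ hy (hf t ht t' ht' h) hne).ne hxy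
    · exact (hlt _ hy _ hx (hf t' ht' t ht h) (Ne.symm hne)).ne hxy.symm
  have hbound : ∀ x ∈ T.image f, g x + Fintype.card ι ≤ ∑ i, (T.image fun t => f t i).card := by
    intro x hx
    obtain ⟨t, ht, rfl⟩ := Finset.mem_image.1 hx
    have : Fintype.card ι = ∑ _i : ι, 1 := by simp
    rw [this, hg, ← Finset.sum_add_distrib]
    refine Finset.sum_le_sum fun i _ => Nat.succ_le_of_lt (Finset.card_lt_card ?_)
    exact Finset.ssubset_iff_of_subset (Finset.filter_subset _ _) |>.2
      ⟨f t i, Finset.mem_image_of_mem _ ht, by simp⟩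
  obtain ⟨t, ht⟩ := hT
  have h0 := hbound _ (Finset.mem_image_of_mem f ht)
  have hsub : (T.image f).image g ⊆
      Finset.range (∑ i, (T.image fun t => f t i).card + 1 - Fintype.card ι) := by
    intro m hm
    obtain ⟨x, hx, rfl⟩ := Finset.mem_image.1 hm
    have := hbound x hx
    rw [Finset.mem_range]
    omega
  have := Finset.card_le_card hsub
  rw [Finset.card_image_of_injOn hinj, Finset.card_range] at this
  omega

end ValueFunctions

/-! ### The growth rate α(k) and Fibonacci numbers. -/

section GrowthRate

theorem growthRate_sq (k : ℕ) : growthRate k ^ 2 = ((k : ℝ) - 1) * growthRate k + 1 := by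
  have h : Real.sqrt (((k : ℝ) - 1) ^ 2 + 4) ^ 2 = ((k : ℝ) - 1) ^ 2 + 4 :=
    Real.sq_sqrt (by positivity)
  rw [growthRate]
  linear_combination h / 4

theorem sub_one_lt_growthRate (k : ℕ) : (k : ℝ) - 1 < growthRate k := by
  have h : (k : ℝ) - 1 < Real.sqrt (((k : ℝ) - 1) ^ 2 + 4) :=
    Real.lt_sqrt_of_sq_lt (by linarith)
  rw [growthRate]
  linarith

theorem growthRate_pos {k : ℕ} (hk : 1 ≤ k) : 0 < growthRate k := by
  have : (1 : ℝ) ≤ k := by exact_mod_cast hk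
  linarith [sub_one_lt_growthRate k]

theorem growthRate_two : growthRate 2 = Real.goldenRatio := by
  rw [growthRate, Real.goldenRatio]
  norm_num

/-- Both sides satisfy the Fibonacci recursion, so two consecutive exponents are carried along. The
constant 4 is generous; n = 0 must be excluded because its Fibonacci number is 0. -/
theorem Real.goldenRatio_pow_le {n : ℕ} (hn : 1 ≤ n) :
    Real.goldenRatio ^ n ≤ 4 * (Nat.fib n : ℝ) := by
  have h2 := Real.goldenRatio_lt_two
  have h0 := Real.goldenRatio_pos
  have key : ∀ n : ℕ, Real.goldenRatio ^ (n + 1) ≤ 4 * (Nat.fib (n + 1) : ℝ) ∧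
      Real.goldenRatio ^ (n + 2) ≤ 4 * (Nat.fib (n + 2) : ℝ) := by
    intro n
    induction n with
    | zero =>
      norm_num [Nat.fib_add_two, Real.goldenRatio_sq]
      constructor <;> linarith
    | succ n ih =>
      refine ⟨ih.2, ?_⟩
      have e : Real.goldenRatio ^ (n + 1 + 2) =
          Real.goldenRatio ^ (n + 1) + Real.goldenRatio ^ (n + 2) := by
        rw [pow_add, Real.goldenRatio_sq]
        ring
      rw [e, Nat.fib_add_two]
      push_cast
      linarith [ih.1, ih.2]
  obtain ⟨m, rfl⟩ := Nat.exists_eq_add_of_le' hn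
  exact (key m).1

/-- One factor k is traded for α(k), as α(k) > k - 1 ≥ k/2. -/
theorem growthRate_bound_le {n k : ℕ} (hn : 1 ≤ n) (hk : 2 ≤ k) :
    5 * (n : ℝ) ^ 3 * (k : ℝ) ^ 2 * growthRate k ^ (n - 1) ≤
      10 * ((n : ℝ) ^ 3 * (k : ℝ) * growthRate k ^ n) := by
  have h1 : (k : ℝ) ≤ 2 * growthRate k := by
    have : (2 : ℝ) ≤ k := by exact_mod_cast hk
    linarith [sub_one_lt_growthRate k]
  have h2 : 0 < growthRate k := growthRate_pos (one_le_two.trans hk)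
  obtain ⟨m, rfl⟩ := Nat.exists_eq_add_of_le' hn
  rw [Nat.add_sub_cancel, pow_succ (growthRate k) m]
  have h3 : 0 ≤ 5 * ((m + 1 : ℕ) : ℝ) ^ 3 * (k : ℝ) * growthRate k ^ m := by positivity
  have := mul_le_mul_of_nonneg_left h1 h3
  linarith

end GrowthRate

/-! ### Counting the policies of a run. -/

section Runs

namespace MDP

variable {S A : Type*} [Fintype S] {M : MDP S A} {π : ℕ → S → A} {m : ℕ}

theorem value_mono_of_isLocallyImproving
    (hπ : ∀ t < m, M.IsLocallyImproving (π t) (π (t + 1))) {t t' : ℕ} (h : t ≤ t')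
    (hm : t' ≤ m) : M.value (π t) ≤ M.value (π t') := by
  induction t', h using Nat.le_induction with
  | base => exact le_rfl
  | succ t' _ ih => exact (ih (by omega)).trans (hπ t' (by omega)).value_le.1

/-- A strict increase at some state is never undone, because no value decreases later. -/
theorem value_injOn_of_isLocallyImproving
    (hπ : ∀ t < m, M.IsLocallyImproving (π t) (π (t + 1))) :
    Set.InjOn (fun t => M.value (π t)) (Finset.range (m + 1)) := by
  have key : ∀ t t', t < t' → t' ≤ m → M.value (π t) ≠ M.value (π t') := by
    intro t t' h hm e
    obtain ⟨s, hs⟩ := (hπ t (by omega)).value_le.2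
    have := value_mono_of_isLocallyImproving hπ (Nat.succ_le_of_lt h) hm s
    rw [← e] at this
    exact absurd hs this.not_gt
  intro t ht t' ht' e
  simp only [Finset.coe_range, Set.mem_Iio] at ht ht'
  rcases lt_trichotomy t t' with h | h | h
  · exact absurd e (key t t' h (by omega))
  · exact h
  · exact absurd e.symm (key t' t h (by omega))

open Classical in
/-- In a state where all actions have the same target, the actions of a run have increasing
rewards. -/
theorem eq_or_reward_lt {next : S → A → S}
    (hnext : ∀ s a s', M.T s a s' = if s' = next s a then 1 else 0)
    (hπ : ∀ t < m, M.IsLocallyImproving (π t) (π (t + 1))) {s : S}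
    (hs : ∀ a a', next s a = next s a') {t t' : ℕ} (h : t ≤ t') (hm : t' ≤ m) :
    π t s = π t' s ∨ M.R s (π t s) < M.R s (π t' s) := by
  induction t', h using Nat.le_induction with
  | base => exact Or.inl rfl
  | succ t' _ ih =>
    have h1 : π (t' + 1) s = π t' s ∨ M.R s (π t' s) < M.R s (π (t' + 1) s) :=
      ((hπ t' (by omega)).gain_pos.1 s).imp_right fun h =>
        reward_lt_of_gain_pos hnext h (hs _ _)
    rcases ih (by omega) with e | e <;> rcases h1 with e' | e'
    · exact Or.inl (e.trans e'.symm)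
    · exact Or.inr (by rwa [e])
    · exact Or.inr (by rwa [e'])
    · exact Or.inr (e.trans e')

/-- Stated for any initial segment of a run, so that it also yields termination. The policies are
grouped by their rewards `f` at the single-target states: at most n k groups, in each of which the
value at every state is one of at most `B` numbers. -/
theorem card_visited_le [Nonempty S] [Fintype A] (hA : 2 ≤ Fintype.card A)
    (hM : M.IsDeterministic) (hπ : ∀ t < m, M.IsLocallyImproving (π t) (π (t + 1))) :
    (m : ℝ) + 1 ≤ 5 * (Fintype.card S : ℝ) ^ 3 * (Fintype.card A : ℝ) ^ 2 *
      growthRate (Fintype.card A) ^ (Fintype.card S - 1) := by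
  classical
  obtain ⟨next, hnext⟩ := hM.exists_next
  have hnext' : ∀ s a s', M.T s a s' =
      @ite ℝ (s' = next s a) (Classical.propDecidable _) 1 0 := hnext
  set n := Fintype.card S with hn
  set k := Fintype.card A with hk
  have hn1 : 1 ≤ n := Fintype.card_pos
  set B : ℝ := k * (n * (2 * growthRate k ^ (n - 1))) with hB
  have hB0 : 0 ≤ B := by
    have := growthRate_pos (one_le_two.trans hA)
    positivity
  set T := Finset.range (m + 1) with hT
  have hTm : ∀ t ∈ T, t ≤ m := fun t ht => Nat.lt_succ_iff.1 (Finset.mem_range.1 ht)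
  set D : S → Prop := fun s => ∀ a a', next s a = next s a' with hD
  set f : ℕ → S → ℝ := fun t s => if D s then M.R s (π t s) else 0 with hf
  have hfmono : ∀ t ∈ T, ∀ t' ∈ T, t ≤ t' → f t ≤ f t' := by
    intro t _ t' ht' h s
    simp only [hf]
    split_ifs with hs
    · rcases eq_or_reward_lt hnext' hπ hs h (hTm t' ht') with e | e
      · rw [e]
      · exact e.le
    · exact le_rfl
  have hfcard : (T.image f).card ≤ n * k := by
    have h1 := Finset.card_image_add_card_le (T := T) ⟨0, by simp [hT]⟩ f hfmono
    have h2 : ∑ s, (T.image fun t => f t s).card ≤ ∑ _s : S, k := by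
      refine Finset.sum_le_sum fun s _ => ?_
      have : (T.image fun t => f t s) ⊆
          Finset.univ.image fun a => if D s then M.R s a else 0 := by
        intro x hx
        obtain ⟨t, _, rfl⟩ := Finset.mem_image.1 hx
        exact Finset.mem_image.2 ⟨π t s, Finset.mem_univ _, rfl⟩
      exact (Finset.card_le_card this).trans Finset.card_image_le
    rw [Finset.sum_const, Finset.card_univ, smul_eq_mul, ← hn] at h2
    rw [← hn] at h1
    omega
  have hfibre : ∀ x ∈ T.image f, ((T.filter fun t => f t = x).card : ℝ) ≤ n * B := by
    intro x hx
    obtain ⟨t₀, ht₀, rfl⟩ := Finset.mem_image.1 hx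
    set U := T.filter fun t => f t = f t₀ with hU
    have hUT : U ⊆ T := Finset.filter_subset _ _
    -- A change of action at such a state would have raised the reward strictly.
    have hagree : ∀ t ∈ U, ∀ s, D s → π t s = π t₀ s := by
      intro t ht s hs
      obtain ⟨h1, h2⟩ := Finset.mem_filter.1 ht
      have h3 := congrFun h2 s
      simp only [hf, if_pos hs] at h3
      rcases le_total t t₀ with h | h
      · exact (eq_or_reward_lt hnext' hπ hs h (hTm _ ht₀)).resolve_right h3.not_lt
      · exact ((eq_or_reward_lt hnext' hπ hs h (hTm _ h1)).resolve_right h3.symm.not_lt).symm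
    have h1 := Finset.card_image_add_card_le (T := U)
      ⟨t₀, Finset.mem_filter.2 ⟨ht₀, rfl⟩⟩ (fun t => M.value (π t))
      fun t _ t' ht' h => value_mono_of_isLocallyImproving hπ h (hTm _ (hUT ht'))
    rw [Finset.card_image_of_injOn ((value_injOn_of_isLocallyImproving hπ).mono
      (Finset.coe_subset.2 hUT))] at h1
    set Act : S → Finset A := fun s => if D s then {π t₀ s} else Finset.univ with hAct
    have h2 : ∀ s, ((U.image fun t => M.value (π t) s).card : ℝ) ≤ B := by
      intro s
      have := card_image_le next Act (α := growthRate k) (β := (k : ℝ) - 1)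
        -- As k is an integer, β = k - 1 is 1 or at least 2.
        (by
          rcases hA.eq_or_lt with h | h
          · left; rw [← h]; norm_num
          · right
            have : (3 : ℝ) ≤ k := by exact_mod_cast h
            linarith)
        (growthRate_pos (one_le_two.trans hA)) (growthRate_sq k) (k := k)
        (fun v => Finset.card_le_univ _)
        (by
          intro v
          by_cases hv : D v
          · exact Or.inl ⟨π t₀ v, by simp only [hAct, if_pos hv]⟩
          · refine Or.inr ?_
            simp only [hAct, if_neg hv, Finset.card_univ, ← hk, sub_add_cancel, true_and,
              Finset.mem_univ]
            simpa [hD] using hv)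
        (s₀ := s) (fun π => M.value π s)
        (fun π π' K hs hK h => value_congr hnext' K hK h hs) (U.image π)
        (by
          intro ρ hρ v
          obtain ⟨t, ht, rfl⟩ := Finset.mem_image.1 hρ
          by_cases hv : D v
          · simpa only [hAct, if_pos hv, Finset.mem_singleton] using hagree t ht v hv
          · simp only [hAct, if_neg hv, Finset.mem_univ])
      rwa [Finset.image_image] at this
    have h3 : (U.card : ℝ) ≤ ∑ s, ((U.image fun t => M.value (π t) s).card : ℝ) := by
      have : U.card ≤ ∑ s, (U.image fun t => M.value (π t) s).card := by omega
      exact_mod_cast this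
    refine h3.trans ((Finset.sum_le_sum fun s _ => h2 s).trans_eq ?_)
    rw [Finset.sum_const, Finset.card_univ, nsmul_eq_mul]
  have h1 : (m : ℝ) + 1 = ∑ x ∈ T.image f, ((T.filter fun t => f t = x).card : ℝ) := by
    have := Finset.card_eq_sum_card_image f T
    rw [hT, Finset.card_range, ← hT] at this
    exact_mod_cast this
  have h2 : (m : ℝ) + 1 ≤ (n * k : ℝ) * (n * B) := by
    rw [h1]
    refine (Finset.sum_le_card_nsmul _ _ _ hfibre).trans ?_
    rw [nsmul_eq_mul]
    gcongr
    exact_mod_cast hfcard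
  refine h2.trans ?_
  have h3 : 0 ≤ (n : ℝ) ^ 3 * (k : ℝ) ^ 2 * growthRate k ^ (n - 1) := by
    have := growthRate_pos (one_le_two.trans hA)
    positivity
  rw [hB]
  -- The product is 2 n³ k² α(k)ⁿ⁻¹; the constant 5 leaves slack.
  linarith

theorem IsRun.exists_terminatesAt [Nonempty S] [Fintype A] (hA : 2 ≤ Fintype.card A)
    (hM : M.IsDeterministic) (hπ : M.IsRun π) :
    ∃ ℓ : ℕ, M.TerminatesAt π ℓ ∧ M.IsOptimal (π ℓ) ∧
      (ℓ : ℝ) + 1 ≤ 5 * (Fintype.card S : ℝ) ^ 3 * (Fintype.card A : ℝ) ^ 2 *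
        growthRate (Fintype.card A) ^ (Fintype.card S - 1) := by
  classical
  have hex : ∃ t, M.improvableSet (π t) = ∅ := by
    by_contra! H
    -- If the run never stopped, its initial segments would exceed the bound.
    obtain ⟨m, hm⟩ := exists_nat_gt (5 * (Fintype.card S : ℝ) ^ 3 * (Fintype.card A : ℝ) ^ 2 *
        growthRate (Fintype.card A) ^ (Fintype.card S - 1))
    have := card_visited_le (m := m) hA hM fun t _ => hπ t (H t)
    linarith
  have hlt : ∀ t < Nat.find hex, (M.improvableSet (π t)).Nonempty := fun t ht =>
    Set.nonempty_iff_ne_empty.2 (Nat.find_min hex ht)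
  exact ⟨Nat.find hex, ⟨hlt, Nat.find_spec hex⟩,
    M.isOptimal_of_improvableSet_eq_empty (Nat.find_spec hex),
    card_visited_le hA hM fun t ht => hπ t (hlt t ht)⟩

theorem IsRun.exists_terminatesAt_of_card_eq_two [Nonempty S] [Fintype A]
    (hA : Fintype.card A = 2) (hM : M.IsDeterministic) (hπ : M.IsRun π) :
    ∃ ℓ : ℕ, M.TerminatesAt π ℓ ∧ M.IsOptimal (π ℓ) ∧
      (ℓ : ℝ) + 1 ≤ 20 * (Fintype.card S : ℝ) ^ 3 * Real.goldenRatio ^ Fintype.card S := by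
  obtain ⟨ℓ, h1, h2, h3⟩ := hπ.exists_terminatesAt hA.ge hM
  refine ⟨ℓ, h1, h2, h3.trans ?_⟩
  rw [hA, ← growthRate_two]
  refine (growthRate_bound_le Fintype.card_pos le_rfl).trans_eq ?_
  push_cast
  ring

end MDP

end Runs

theorem mainTheorem1 :
    -- every run on an `n`-state, `k`-action DMDP stops, at an optimal policy, and visits at most
    -- `5 n³ k² α(k)ⁿ⁻¹` policies
    (∀ (S : Type u) (A : Type v) [Fintype S] [Fintype A] (M : MDP S A) (π : ℕ → S → A),
      2 ≤ Fintype.card S → 2 ≤ Fintype.card A → M.IsDeterministic → M.IsRun π →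
      ∃ ℓ : ℕ, M.TerminatesAt π ℓ ∧ M.IsOptimal (π ℓ) ∧
        (ℓ : ℝ) + 1 ≤ 5 * (Fintype.card S : ℝ) ^ 3 * (Fintype.card A : ℝ) ^ 2 *
          growthRate (Fintype.card A) ^ (Fintype.card S - 1)) ∧
    -- the bound is `O(n³ k α(k)ⁿ)`, uniformly in `n` and `k`
    (∃ C : ℝ, 0 < C ∧ ∀ n k : ℕ, 2 ≤ n → 2 ≤ k →
      5 * (n : ℝ) ^ 3 * (k : ℝ) ^ 2 * growthRate k ^ (n - 1) ≤
        C * ((n : ℝ) ^ 3 * (k : ℝ) * growthRate k ^ n)) ∧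
    -- two actions: `O(n³ φⁿ)` for every run
    (∃ C : ℝ, 0 < C ∧
      ∀ (S : Type u) (A : Type v) [Fintype S] [Fintype A] (M : MDP S A) (π : ℕ → S → A),
        2 ≤ Fintype.card S → Fintype.card A = 2 → M.IsDeterministic → M.IsRun π →
        ∃ ℓ : ℕ, M.TerminatesAt π ℓ ∧ M.IsOptimal (π ℓ) ∧
          (ℓ : ℝ) + 1 ≤ C * (Fintype.card S : ℝ) ^ 3 * Real.goldenRatio ^ Fintype.card S) ∧
    -- two actions, Howard's policy iteration: Fibonacci growth up to a polynomial factor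
    (∃ C : ℝ, 0 < C ∧
      ∀ (S : Type u) (A : Type v) [Fintype S] [Fintype A] (M : MDP S A) (π : ℕ → S → A),
        2 ≤ Fintype.card S → Fintype.card A = 2 → M.IsDeterministic → M.IsHowardRun π →
        ∃ ℓ : ℕ, M.TerminatesAt π ℓ ∧ M.IsOptimal (π ℓ) ∧
          (ℓ : ℝ) + 1 ≤ C * (Fintype.card S : ℝ) ^ 3 * (Nat.fib (Fintype.card S) : ℝ)) := by
  have hne : ∀ (S : Type u) [Fintype S], 2 ≤ Fintype.card S → Nonempty S := fun S _ h =>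
    Fintype.card_pos_iff.1 (two_pos.trans_le h)
  -- The constant 20 is 10 k for k = 2, and 80 = 20 · 4 with the 4 of `Real.goldenRatio_pow_le`.
  refine ⟨?_, ⟨10, by norm_num, ?_⟩, ⟨20, by norm_num, ?_⟩, ⟨80, by norm_num, ?_⟩⟩
  · intro S A _ _ M π hS hA hM hπ
    have := hne S hS
    exact hπ.exists_terminatesAt hA hM
  · intro n k hn hk
    exact growthRate_bound_le (one_le_two.trans hn) hk
  · intro S A _ _ M π hS hA hM hπ
    have := hne S hS
    exact hπ.exists_terminatesAt_of_card_eq_two hA hM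
  · intro S A _ _ M π hS hA hM hπ
    have := hne S hS
    obtain ⟨ℓ, h1, h2, h3⟩ := hπ.isRun.exists_terminatesAt_of_card_eq_two hA hM
    refine ⟨ℓ, h1, h2, h3.trans ?_⟩
    have h4 := mul_le_mul_of_nonneg_left
      (Real.goldenRatio_pow_le (one_le_two.trans hS))
      (by positivity : (0 : ℝ) ≤ 20 * (Fintype.card S : ℝ) ^ 3)
    linarith
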